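/- Let $\sigma,r>0$, $\nu=\sigma/\sqrt2$, $\gamma=\frac r\nu-\nu$, and let $s,\tau\in\mathbb R$ with $0<\nu<1$, $s>1$, $\tau\ge 0$ and $s\nu>1$. Let $$Y^{s,\tau}=\Big\{u\in C((0,\infty),\mathbb C):\ \lim_{x\to\infty}\frac{u(x)}{1+x^s}=0,\ \lim_{x\to0^+}\frac{u(x)}{1+x^{-\tau}}=0\Big\},\qquad \|u\|=\sup_{x>0}\Big|\frac{u(x)}{(1+x^s)(1+x^{-\tau})}\Big| .$$ Let $D_\nu=\nu x\frac{d}{dx}$ with domain $\{u\in Y^{s,\tau}\cap C^1(0,\infty): \nu xu'\in Y^{s,\tau}\}$, let $\mathcal B=D_\nu^2+\gamma D_\nu-rI$ with domain $D(D_\nu^2)$ (the Black–Scholes operator $\frac12\sigma^2x^2\frac{d^2}{dx^2}+rx\frac{d}{dx}-r$), and put $g(z)=z^2+\gamma z-r$ and $S_s=\{z\in\mathbb C:0<\operatorname{Re}z<s\nu\}$. Then $Y^{s,\tau}$ is a separable complex Banach space, $\mathcal B$ is the generator of a unique $C_0$-semigroup $(T_t)_{t\ge0}$ on $Y^{s,\tau}$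 (the Black–Scholes semigroup), and the following hold. 1. (Desch–Schappacher–Webb spectral criterion.) The map $L:S_s\to Y^{s,\tau}$, $L(z)(x)=x^{z/\nu}$, is well defined and weakly holomorphic. There are an open ball $U\subset g(S_s)$ with $U\cap i\mathbb R\ne\emptyset$ and $U\cap\mathbb R=\emptyset$, and a holomorphic map $g^{-1}:U\to S_s$ with $g(g^{-1}(\lambda))=\lambda$ for all $\lambda\in U$, such that $F=L\circ g^{-1}$ is weakly holomorphic on $U$, $F(\lambda)\neq0$, $F(\lambda)\in D(\mathcal B)$ and $\mathcal BF(\lambda)=\lambda F(\lambda)$ for all $\lambda\in U$, and the only $\psi\in(Y^{s,\tau})^*$ with $\langle F(\lambda),\psi\rangle=0$ for all $\lambda\in U$ is $\psi=0$. 2. There is a family of $C^2$ maps $f_j:I_j\to Y^{s,\tau}$ $(j\in\Gamma)$ on nondegenerate intervals $I_j\subset\mathbb R$ with $f_j(t)\in D(\mathcal B)$ and $\mathcal Bf_j(t)=itf_j(t)$ for all $t\in I_j$, $j\in\Gamma$, and such that $\operatorname{span}\{f_j(t):j\in\Gamma,\ t\in I_j\}$ is dense in $Y^{s,\tau}$.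 3. There is a Borel probability measure $\mu$ on $Y^{s,\tau}$ that is invariant ($\mu(T_t^{-1}(B))=\mu(B)$ for all $t\ge 0$ and all Borel sets $B$), strongly mixing ($\lim_{t\to\infty}\mu(A\cap T_t^{-1}(B))=\mu(A)\mu(B)$ for all Borel sets $A,B$) and has full support ($\mu(V)>0$ for every non-empty open set $V$). -/

import Mathlib

open Set Filter Topology MeasureTheory
open scoped NNReal

/-! ## Strongly continuous semigroups, their generators, and measures -/

section Semigroups

variable {X : Type*} [NormedAddCommGroup X] [NormedSpace ℂ X]

/-- A `C₀`-semigroup of bounded linear operators on `X`. -/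
@[ext]
structure C0Semigroup (X : Type*) [NormedAddCommGroup X] [NormedSpace ℂ X] where
  /-- The operator at time `t ≥ 0`. -/
  op : ℝ≥0 → X →L[ℂ] X
  op_zero : op 0 = ContinuousLinearMap.id ℂ X
  op_add : ∀ t t' : ℝ≥0, op (t + t') = (op t).comp (op t')
  continuous_orbit : ∀ x : X, Continuous fun t : ℝ≥0 => op t x

/-- The infinitesimal generator `(A, D(A))` of a `C₀`-semigroup, given by its graph: `(x, y)` belongs
to it iff `x ∈ D(A)` and `A x = y`, i.e. iff `(T_h x - x) / h → y` as `h → 0+`. -/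
def C0Semigroup.generator (T : C0Semigroup X) : Set (X × X) :=
  {p | Tendsto (fun h : ℝ≥0 => (h : ℝ)⁻¹ • (T.op h p.1 - p.1)) (𝓝[>] 0) (𝓝 p.2)}

/-- `F` is weakly holomorphic on `U`. -/
def WeaklyHolomorphicOn (F : ℂ → X) (U : Set ℂ) : Prop :=
  ∀ φ : X →L[ℂ] ℂ, DifferentiableOn ℂ (fun z => φ (F z)) U

/-- The Desch–Schappacher–Webb spectral criterion for an operator with graph `A`, with the eigenvector
field `F` on the open connected set `U`: the set `U` meets the imaginary axis, `F` is a weakly holomorphic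
field of eigenvectors (`F z ≠ 0` and `A (F z) = z F z`) on `U`, and no nonzero continuous functional
vanishes on all the `F z`. -/
structure SpectralCriterion (A : Set (X × X)) (U : Set ℂ) (F : ℂ → X) : Prop where
  isOpen : IsOpen U
  isConnected : IsConnected U
  meets_imaginary_axis : ∃ t : ℝ, (t : ℂ) * Complex.I ∈ U
  ne_zero : ∀ z ∈ U, F z ≠ 0
  eigen : ∀ z ∈ U, (F z, z • F z) ∈ A
  weaklyHolomorphic : WeaklyHolomorphicOn F U
  total : ∀ φ : X →L[ℂ] ℂ, (∀ z ∈ U, φ (F z) = 0) → φ = 0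

/-- There is a family `f_j : I_j → X` of `C²` maps on nondegenerate intervals (in particular they are
locally bounded and measurable) such that `A (f_j t) = i t f_j t` for `t ∈ I_j`, and such that all the
vectors `f_j t` together span a dense subspace of `X`. -/
def HasC2ImaginaryEigenfields (A : Set (X × X)) : Prop :=
  ∃ (Γ : Type) (J : Γ → Set ℝ) (f : Γ → ℝ → X),
    (∀ j, (J j).OrdConnected ∧ (interior (J j)).Nonempty) ∧
    (∀ j, ContDiffOn ℝ 2 (f j) (J j)) ∧
    (∀ j, ∀ t ∈ J j, (f j t, (Complex.I * (t : ℂ)) • f j t) ∈ A) ∧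
    Dense (Submodule.span ℂ {x : X | ∃ j, ∃ t ∈ J j, f j t = x} : Set X)

/-- `μ` is a `(T_t)`-invariant strongly mixing Borel probability measure with full support. -/
structure IsInvariantMixingFullSupport [MeasurableSpace X] [BorelSpace X]
    (T : C0Semigroup X) (μ : Measure X) : Prop where
  isProbabilityMeasure : IsProbabilityMeasure μ
  invariant : ∀ t : ℝ≥0, ∀ B : Set X, MeasurableSet B → μ (T.op t ⁻¹' B) = μ B
  mixing : ∀ B C : Set X, MeasurableSet B → MeasurableSet C →
    Tendsto (fun t : ℝ≥0 => μ (B ∩ T.op t ⁻¹' C)) atTop (𝓝 (μ B * μ C))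
  fullSupport : ∀ V : Set X, IsOpen V → V.Nonempty → 0 < μ V

end Semigroups

/-! ## The weighted space `Y^{s,τ}` -/

/-- The weight `(1 + x^s) (1 + x^{-τ})` on `(0, ∞)`. -/
noncomputable def bsWeight (s τ : ℝ) (x : Ioi (0 : ℝ)) : ℝ :=
  (1 + (x : ℝ) ^ s) * (1 + (x : ℝ) ^ (-τ))

theorem bsWeight_pos (s τ : ℝ) (x : Ioi (0 : ℝ)) : 0 < bsWeight s τ x := by
  have hx : (0 : ℝ) < x := x.2
  unfold bsWeight
  positivity

/-- The linear space of all continuous `u : (0, ∞) → ℂ` with `u x / (1 + x^s) → 0` as `x → ∞` and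
`u x / (1 + x^{-τ}) → 0` as `x → 0+`. -/
noncomputable def bsSubmodule (s τ : ℝ) : Submodule ℂ C(Ioi (0 : ℝ), ℂ) where
  carrier := {u |
    Tendsto (fun x : Ioi (0 : ℝ) => u x / ((1 + (x : ℝ) ^ s : ℝ) : ℂ))
      (comap (fun x : Ioi (0 : ℝ) => (x : ℝ)) atTop) (𝓝 0) ∧
    Tendsto (fun x : Ioi (0 : ℝ) => u x / ((1 + (x : ℝ) ^ (-τ) : ℝ) : ℂ))
      (comap (fun x : Ioi (0 : ℝ) => (x : ℝ)) (𝓝 0)) (𝓝 0)}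
  add_mem' := by
    rintro u v ⟨hu, hu'⟩ ⟨hv, hv'⟩
    refine ⟨?_, ?_⟩
    · simpa [add_div] using hu.add hv
    · simpa [add_div] using hu'.add hv'
  zero_mem' := by
    refine ⟨?_, ?_⟩ <;> simpa using tendsto_const_nhds
  smul_mem' := by
    rintro c u ⟨hu, hu'⟩
    refine ⟨?_, ?_⟩
    · simpa [mul_div_assoc] using hu.const_mul c
    · simpa [mul_div_assoc] using hu'.const_mul c

/-- The space `Y^{s,τ}`; its norm is defined below. -/
def BSSpace (s τ : ℝ) : Type := ↥(bsSubmodule s τ)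

namespace BSSpace

variable {s τ : ℝ}

noncomputable instance : AddCommGroup (BSSpace s τ) :=
  inferInstanceAs (AddCommGroup ↥(bsSubmodule s τ))

noncomputable instance : Module ℂ (BSSpace s τ) :=
  inferInstanceAs (Module ℂ ↥(bsSubmodule s τ))

/-- The value of `u ∈ Y^{s,τ}` at `x > 0`. -/
noncomputable def val (u : BSSpace s τ) (x : Ioi (0 : ℝ)) : ℂ := u.1 x

noncomputable instance : CoeFun (BSSpace s τ) (fun _ => Ioi (0 : ℝ) → ℂ) := ⟨val⟩

/-- `‖u‖ = sup_{x > 0} |u x / ((1 + x^s) (1 + x^{-τ}))|`. -/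
noncomputable instance : Norm (BSSpace s τ) :=
  ⟨fun u => ⨆ x : Ioi (0 : ℝ), ‖u x‖ / bsWeight s τ x⟩

theorem norm_def (u : BSSpace s τ) : ‖u‖ = ⨆ x : Ioi (0 : ℝ), ‖u x‖ / bsWeight s τ x := rfl

theorem bddAbove_range (u : BSSpace s τ) :
    BddAbove (range fun x : Ioi (0 : ℝ) => ‖u x‖ / bsWeight s τ x) := by
  obtain ⟨h1, h2⟩ := u.2
  have key : ∀ {a b c : ℝ}, 0 < a → 0 < b → 0 ≤ c → c / a < 1 → c / (a * b + a) ≤ 1 := by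
    intro a b c ha hb hc h
    rw [div_lt_one ha] at h
    rw [div_le_one (by positivity)]
    nlinarith [mul_pos ha hb]
  have e1 : ∀ᶠ x in comap (fun x : Ioi (0 : ℝ) => (x : ℝ)) atTop,
      ‖u x‖ / bsWeight s τ x ≤ 1 := by
    have := h1.norm
    rw [norm_zero] at this
    filter_upwards [this.eventually (gt_mem_nhds one_pos)] with x hx
    have hx0 : (0 : ℝ) < x := x.2
    have hp : (0 : ℝ) < 1 + (x : ℝ) ^ s := by positivity
    rw [norm_div, Complex.norm_real, Real.norm_of_nonneg hp.le] at hx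
    have := key hp (Real.rpow_pos_of_pos hx0 (-τ)) (norm_nonneg _) hx
    unfold bsWeight
    have h3 : (1 + (x : ℝ) ^ s) * (1 + (x : ℝ) ^ (-τ)) =
        (1 + (x : ℝ) ^ s) * (x : ℝ) ^ (-τ) + (1 + (x : ℝ) ^ s) := by ring
    rwa [h3]
  have e2 : ∀ᶠ x in comap (fun x : Ioi (0 : ℝ) => (x : ℝ)) (𝓝 0),
      ‖u x‖ / bsWeight s τ x ≤ 1 := by
    have := h2.norm
    rw [norm_zero] at this
    filter_upwards [this.eventually (gt_mem_nhds one_pos)] with x hx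
    have hx0 : (0 : ℝ) < x := x.2
    have hp : (0 : ℝ) < 1 + (x : ℝ) ^ (-τ) := by positivity
    rw [norm_div, Complex.norm_real, Real.norm_of_nonneg hp.le] at hx
    have := key hp (Real.rpow_pos_of_pos hx0 s) (norm_nonneg _) hx
    unfold bsWeight
    have h3 : (1 + (x : ℝ) ^ s) * (1 + (x : ℝ) ^ (-τ)) =
        (1 + (x : ℝ) ^ (-τ)) * (x : ℝ) ^ s + (1 + (x : ℝ) ^ (-τ)) := by ring
    rwa [h3]
  rw [eventually_comap, eventually_atTop] at e1
  rw [eventually_comap, Metric.eventually_nhds_iff] at e2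
  obtain ⟨M, hM⟩ := e1
  obtain ⟨ε, hε, hε'⟩ := e2
  have hK : IsCompact ((fun x : Ioi (0 : ℝ) => (x : ℝ)) ⁻¹' Icc ε M) := by
    refine Topology.IsInducing.subtypeVal.isCompact_preimage' isCompact_Icc ?_
    intro y hy
    exact ⟨⟨y, mem_Ioi.2 (hε.trans_le hy.1)⟩, rfl⟩
  have hcont : Continuous fun x : Ioi (0 : ℝ) => ‖u x‖ / bsWeight s τ x := by
    have hu : Continuous fun x : Ioi (0 : ℝ) => u x := u.1.continuous
    have hw : Continuous fun x : Ioi (0 : ℝ) => bsWeight s τ x := by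
      unfold bsWeight
      refine (continuous_const.add ?_).mul (continuous_const.add ?_)
      · exact continuous_subtype_val.rpow_const fun x => Or.inl (ne_of_gt x.2)
      · exact continuous_subtype_val.rpow_const fun x => Or.inl (ne_of_gt x.2)
    exact hu.norm.div hw fun x => (bsWeight_pos s τ x).ne'
  obtain ⟨C, hC⟩ := (hK.image hcont).bddAbove
  refine ⟨max 1 C, ?_⟩
  rintro _ ⟨x, rfl⟩
  have hx0 : (0 : ℝ) < x := x.2
  rcases lt_or_ge (x : ℝ) ε with h | h
  · refine le_max_of_le_left (hε' (y := (x : ℝ)) ?_ x rfl)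
    simpa [Real.dist_eq, abs_of_pos hx0] using h
  · rcases le_or_gt (x : ℝ) M with h' | h'
    · exact le_max_of_le_right (hC ⟨x, ⟨h, h'⟩, rfl⟩)
    · exact le_max_of_le_left (hM x h'.le x rfl)

theorem norm_core : NormedSpace.Core ℂ (BSSpace s τ) where
  norm_nonneg u := Real.iSup_nonneg fun x => div_nonneg (norm_nonneg _) (bsWeight_pos s τ x).le
  norm_smul c u := by
    rw [norm_def, norm_def, Real.mul_iSup_of_nonneg (norm_nonneg c)]
    refine iSup_congr fun x => ?_
    rw [← mul_div_assoc, ← norm_mul]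
    rfl
  norm_triangle u v := by
    have : Nonempty (Ioi (0 : ℝ)) := ⟨⟨1, mem_Ioi.2 one_pos⟩⟩
    rw [norm_def]
    refine ciSup_le fun x => ?_
    have h1 := le_ciSup u.bddAbove_range x
    have h2 := le_ciSup v.bddAbove_range x
    refine le_trans ?_ (add_le_add h1 h2)
    rw [← add_div]
    exact div_le_div_of_nonneg_right (norm_add_le _ _) (bsWeight_pos s τ x).le
  norm_eq_zero_iff u := by
    constructor
    · intro h
      refine Subtype.ext (ContinuousMap.ext fun x => ?_)
      have h1 := le_ciSup u.bddAbove_range x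
      rw [← norm_def, h, div_le_iff₀ (bsWeight_pos s τ x), zero_mul] at h1
      exact norm_le_zero_iff.1 h1
    · rintro rfl
      have : ∀ x : Ioi (0 : ℝ), ‖(0 : BSSpace s τ) x‖ / bsWeight s τ x = 0 := fun x => by
        have : (0 : BSSpace s τ) x = 0 := rfl
        simp [this]
      simp [norm_def, this]

noncomputable instance : NormedAddCommGroup (BSSpace s τ) := NormedAddCommGroup.ofCore norm_core

noncomputable instance : NormedSpace ℂ (BSSpace s τ) := NormedSpace.ofCore norm_core

/-- The Borel σ-algebra of the norm topology. -/
noncomputable instance : MeasurableSpace (BSSpace s τ) := borel _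

instance : BorelSpace (BSSpace s τ) := ⟨rfl⟩

end BSSpace

/-! ## The Black–Scholes operator -/

/-- The graph of `D_ν = ν x d/dx` in `Y^{s,τ}`, with domain
`{u ∈ Y^{s,τ} ∩ C¹(0,∞) : ν x u' ∈ Y^{s,τ}}`. (The extension of `u` by an arbitrary value to `x ≤ 0` plays
no role for the derivative at `x > 0`.) -/
def bsD (ν s τ : ℝ) : Set (BSSpace s τ × BSSpace s τ) :=
  {p | ∀ x : Ioi (0 : ℝ), ∃ d : ℂ,
    HasDerivAt (fun y : ℝ => if hy : 0 < y then p.1 ⟨y, hy⟩ else 0) d (x : ℝ) ∧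
    p.2 x = (ν : ℂ) * ((x : ℝ) : ℂ) * d}

/-- The graph of the Black–Scholes operator `(D_ν)² + γ D_ν - r I` in `Y^{s,τ}`, with domain
`D((D_ν)²) = {u ∈ D(D_ν) : D_ν u ∈ D(D_ν)}`. -/
def bsOperator (ν γ r s τ : ℝ) : Set (BSSpace s τ × BSSpace s τ) :=
  {p | ∃ v w : BSSpace s τ, (p.1, v) ∈ bsD ν s τ ∧ (v, w) ∈ bsD ν s τ ∧
    p.2 = w + (γ : ℂ) • v - (r : ℂ) • p.1}

/-- `g(z) = z² + γ z - r`. -/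
noncomputable def bsSymbol (γ r : ℝ) (z : ℂ) : ℂ := z ^ 2 + (γ : ℂ) * z - (r : ℂ)

/-- The open strip `S_s = {z : 0 < Re z < s ν}`. -/
def bsStrip (ν s : ℝ) : Set ℂ := {z | 0 < z.re ∧ z.re < s * ν}

/-!
In the variable `y = log x` the space `Y^{s,τ}` is isometric to `C₀(ℝ)`, and the powers `x ^ κ` with
`0 < Re κ < s` become the exponentials `exp (κ y)`. They depend holomorphically on `κ`
(`BSSpace.differentiableOn_power`) and span a dense subspace (`BSSpace.dense_span_power`), since a
function of compact support in `y` is approximated by trigonometric polynomials of large period.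
As `x ^ (z / ν)` is an eigenvector of the Black–Scholes operator `ν² d²/dy² + γ ν d/dy - r` for the
eigenvalue `g(z)`, everything follows from the action on these vectors.

*The semigroup.* Averaging the translations in `y` over normal distributions yields operators that
multiply `x ^ (z / ν)` by `exp (t g(z))`, and density turns this into the semigroup laws
(`BSSpace.diffusion`). For a large real number `c` the polynomial `c - g(ν κ)` in `κ` has two real
roots `κ₁`, `κ₂` of absolute value larger than `s + τ`, the growth rate of the translations. The product
of the resolvents of `d/dy` at these roots, which are Laplace transforms of the translations, is up to
a constant factor the resolvent at `c` of the generator and of the differential operator, so they agree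
(`BSSpace.generator_diffusion`). Uniqueness is clear from the action on the eigenvectors.

*The spectral criterion.* The symbol takes a positive multiple of `i` at some point of every line
`Re z = a` with `a > ν` (`exists_bsSymbol_eq_mul_I`), and there a branch of the square root inverts it.
If a functional vanishes on the resulting eigenvectors, the identity theorem shows that it vanishes
on all powers, hence it is zero. The same argument applies to the eigenvectors for an interval of the
imaginary axis only, which gives the `C²` eigenfield.

*The invariant measure.* Let `F` be that eigenfield on `[a, b] i`, cut off so as to vanish at the ends.
Its Fourier coefficients `eₙ` are absolutely summable, and the random series `∑ (gₙ + i gₙ') eₙ` with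
independent standard normal coefficients has a law with characteristic function
`exp (-(b - a)⁻¹ ∫ |φ (F θ)|² dθ / 2)`, by Parseval's identity. The semigroup multiplies `F θ` by
`exp (i θ t)`, which gives invariance, and the Riemann–Lebesgue lemma gives the convergence of the joint
characteristic functions at the times `0` and `t` to a product, hence strong mixing
(`exists_isInvariantMixingFullSupport`, `tendsto_measure_inter_preimage_of_charFunDual`). Full support
comes from totality of the eigenfield (`gaussianLaw_pos_of_isOpen`).
-/

/-! ### Dense spans and strong convergence -/

section DenseSpan

variable {X Y : Type*} [NormedAddCommGroup X] [NormedAddCommGroup Y]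

/-- For operators that are eventually uniformly bounded, strong convergence has to be checked only
on a set with dense span. -/
theorem tendsto_clm_apply_of_dense_span [NormedSpace ℂ X] [NormedSpace ℂ Y] {ι : Type*}
    {l : Filter ι} {P : ι → X →L[ℂ] Y} {Q : X →L[ℂ] Y} {M : ℝ} (hM : ∀ᶠ i in l, ‖P i‖ ≤ M)
    {S : Set X} (hS : Dense (Submodule.span ℂ S : Set X))
    (h : ∀ x ∈ S, Tendsto (fun i => P i x) l (𝓝 (Q x))) (x : X) :
    Tendsto (fun i => P i x) l (𝓝 (Q x)) := by
  have h1 : ∀ y ∈ Submodule.span ℂ S, Tendsto (fun i => P i y) l (𝓝 (Q y)) := by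
    intro y hy
    induction hy using Submodule.span_induction with
    | mem y hy => exact h y hy
    | zero => simpa using tendsto_const_nhds
    | add y z _ _ hy hz => simpa using hy.add hz
    | smul c y _ hy => simpa using hy.const_smul c
  rw [Metric.tendsto_nhds]
  intro ε hε
  set K : ℝ := |M| + ‖Q‖ + 1 with hK
  have hK0 : 0 < K := by positivity
  obtain ⟨y, hy, hxy⟩ := Metric.mem_closure_iff.1 (hS x) (ε / (2 * K)) (by positivity)
  filter_upwards [hM, Metric.tendsto_nhds.1 (h1 y hy) (ε / 2) (by positivity)] with i hi hi'
  rw [dist_eq_norm] at *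
  have e : P i x - Q x = P i (x - y) + (P i y - Q y) - Q (x - y) := by
    simp only [map_sub]; abel
  have b1 : ‖P i (x - y)‖ ≤ |M| * ‖x - y‖ := (P i).le_of_opNorm_le (hi.trans (le_abs_self M)) _
  have b2 : ‖Q (x - y)‖ ≤ ‖Q‖ * ‖x - y‖ := Q.le_opNorm _
  have b3 : K * ‖x - y‖ < ε / 2 := by
    rw [lt_div_iff₀ (by positivity)] at hxy
    nlinarith
  calc ‖P i x - Q x‖ ≤ ‖P i (x - y)‖ + ‖P i y - Q y‖ + ‖Q (x - y)‖ := by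
        rw [e]; exact (norm_sub_le _ _).trans (by gcongr; exact norm_add_le _ _)
    _ < ε := by nlinarith [norm_nonneg (x - y)]

/-- A locally bounded and strongly continuous family of operators is jointly continuous. -/
theorem continuous_clm_apply_of_locally_bounded [NormedSpace ℂ X] [NormedSpace ℂ Y] {T : Type*}
    [TopologicalSpace T] {P : T → X →L[ℂ] Y} (hM : ∀ t₀, ∃ M, ∀ᶠ t in 𝓝 t₀, ‖P t‖ ≤ M)
    (h : ∀ x, Continuous fun t => P t x) : Continuous fun p : T × X => P p.1 p.2 := by
  rw [continuous_iff_continuousAt]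
  rintro ⟨t₀, x₀⟩
  obtain ⟨M, hM⟩ := hM t₀
  have e : (fun p : T × X => P p.1 p.2) = fun p => P p.1 (p.2 - x₀) + P p.1 x₀ := by
    ext p; simp
  rw [ContinuousAt, e]
  have h2 : Tendsto (fun p : T × X => P p.1 x₀) (𝓝 (t₀, x₀)) (𝓝 (P t₀ x₀)) :=
    ((h x₀).comp continuous_fst).tendsto (t₀, x₀)
  change Tendsto _ _ (𝓝 (P t₀ x₀))
  rw [show P t₀ x₀ = 0 + P t₀ x₀ by simp]
  refine Tendsto.add ?_ h2
  refine squeeze_zero_norm' (a := fun p => M * ‖p.2 - x₀‖) ?_ ?_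
  · filter_upwards [(continuous_fst.tendsto (t₀, x₀)).eventually hM] with p hp
    exact (P p.1).le_of_opNorm_le hp _
  · have : Continuous fun p : T × X => M * ‖p.2 - x₀‖ := by fun_prop
    simpa using this.tendsto (t₀, x₀)

/-- A set on which only the zero functional vanishes has a dense span (Hahn–Banach). -/
theorem dense_span_of_forall_dual {𝕜 : Type*} [RCLike 𝕜] [NormedSpace 𝕜 X] {S : Set X}
    (h : ∀ φ : X →L[𝕜] 𝕜, (∀ x ∈ S, φ x = 0) → φ = 0) :
    Dense (Submodule.span 𝕜 S : Set X) := by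
  rw [Submodule.dense_iff_topologicalClosure_eq_top, Submodule.eq_top_iff']
  intro x
  by_contra hx
  set p := (Submodule.span 𝕜 S).topologicalClosure
  have : IsClosed (p : Set X) := Submodule.isClosed_topologicalClosure _
  have hq : p.mkQ x ≠ 0 := by simpa using hx
  obtain ⟨g, hg⟩ := SeparatingDual.exists_ne_zero (R := 𝕜) hq
  have := h (g.comp p.mkQL) (fun y hy => by
    have hy' : p.mkQ y = 0 := by
      simpa using Submodule.le_topologicalClosure _ (Submodule.subset_span hy)
    change g (p.mkQ y) = 0
    rw [hy', map_zero])
  exact hg (by simpa using DFunLike.congr_fun this x)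

end DenseSpan

/-! ### Orbits of `C₀`-semigroups -/

namespace C0Semigroup

variable {X : Type*} [NormedAddCommGroup X] [NormedSpace ℂ X] (T : C0Semigroup X)

/-- The generator is the right derivative of the orbit at time zero. -/
theorem mem_generator_iff {x y : X} : (x, y) ∈ T.generator ↔
    HasDerivWithinAt (fun h : ℝ => T.op h.toNNReal x) y (Ici 0) 0 := by
  rw [hasDerivWithinAt_iff_tendsto_slope,
    show Ici (0 : ℝ) \ {0} = Ioi 0 by ext; simp [lt_iff_le_and_ne, eq_comm]]
  have e : ∀ h : ℝ, 0 < h → slope (fun h : ℝ => T.op h.toNNReal x) 0 h =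
      ((h.toNNReal : ℝ≥0) : ℝ)⁻¹ • (T.op h.toNNReal x - x) := by
    intro h hh
    simp [slope_def_module, T.op_zero, Real.coe_toNNReal h hh.le]
  constructor
  · intro h
    have h1 : Tendsto Real.toNNReal (𝓝[>] 0) (𝓝[>] 0) := by
      refine tendsto_nhdsWithin_iff.2 ⟨?_, ?_⟩
      · simpa using continuous_real_toNNReal.continuousWithinAt.tendsto (x := (0 : ℝ))
      · filter_upwards [self_mem_nhdsWithin] with t ht using Real.toNNReal_pos.2 ht
    refine (Tendsto.comp h h1).congr' ?_
    filter_upwards [self_mem_nhdsWithin] with t ht using (e t ht).symm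
  · intro h
    have h1 : Tendsto ((↑) : ℝ≥0 → ℝ) (𝓝[>] 0) (𝓝[>] 0) := by
      refine tendsto_nhdsWithin_iff.2 ⟨?_, ?_⟩
      · simpa using NNReal.continuous_coe.continuousWithinAt.tendsto (x := (0 : ℝ≥0))
      · filter_upwards [self_mem_nhdsWithin] with t ht using NNReal.coe_pos.2 ht
    refine (Tendsto.comp h h1).congr' ?_
    filter_upwards [self_mem_nhdsWithin] with t ht
    simp only [Function.comp_apply]
    rw [e t (NNReal.coe_pos.2 ht), Real.toNNReal_coe]

/-- Eigenvectors of the generator are eigenvectors of the semigroup. -/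
theorem op_apply_of_mem_generator {x : X} {c : ℂ} (h : (x, c • x) ∈ T.generator) (t : ℝ≥0) :
    T.op t x = Complex.exp (c * (t : ℝ)) • x := by
  rw [mem_generator_iff] at h
  have hexp : ∀ a : ℝ, HasDerivAt (fun a : ℝ => Complex.exp (-c * a))
      (Complex.exp (-c * a) * -c) a := by
    intro a
    have := ((hasDerivAt_id (a : ℂ)).const_mul (-c)).cexp.comp_ofReal
    simpa using this
  set G : ℝ → X := fun a => Complex.exp (-c * a) • T.op a.toNNReal x with hG
  have hG0 : HasDerivWithinAt G 0 (Ici 0) 0 := by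
    have := (hexp 0).hasDerivWithinAt (s := Ici 0) |>.smul h
    exact (this : HasDerivWithinAt G _ _ _).congr_deriv (by simp [T.op_zero])
  have hcont : Continuous G := by
    have : Continuous fun a : ℝ => T.op a.toNNReal x :=
      (T.continuous_orbit x).comp continuous_real_toNNReal
    fun_prop
  have key := constant_of_has_deriv_right_zero (f := G) (a := 0) (b := t) hcont.continuousOn
    (fun a ha => by
      have h1 : HasDerivWithinAt (fun b => G (b - a)) 0 (Ici a) a := by
        have := HasDerivWithinAt.scomp (g₁ := G) (h := fun b : ℝ => b - a) (t' := Ici 0)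
          (s := Ici a) (h' := 1) (g₁' := 0) a (by simpa using hG0)
          ((hasDerivAt_id a).sub_const a).hasDerivWithinAt (fun b hb => by simpa using hb)
        simpa [Function.comp_def] using this
      have h2 : HasDerivWithinAt (fun b => Complex.exp (-c * a) •
          T.op a.toNNReal (G (b - a))) 0 (Ici a) a := by
        have := (((T.op a.toNNReal).restrictScalars ℝ).hasFDerivAt.comp_hasDerivWithinAt a
          h1).const_smul (Complex.exp (-c * a))
        exact HasDerivWithinAt.congr_deriv this (by simp)
      refine h2.congr_of_mem (fun b hb => ?_) self_mem_Ici
      have hb' : (0 : ℝ) ≤ b - a := sub_nonneg.2 hb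
      have e1 : b.toNNReal = a.toNNReal + (b - a).toNNReal := by
        rw [← Real.toNNReal_add ha.1 hb']; congr 1; ring
      have e2 : Complex.exp (-c * b) = Complex.exp (-c * a) * Complex.exp (-c * ↑(b - a)) := by
        rw [← Complex.exp_add]; congr 1; push_cast; ring
      simp only [hG, map_smul, smul_smul, e1, T.op_add, e2, ContinuousLinearMap.comp_apply])
    t ⟨t.2, le_rfl⟩
  simp only [hG, Real.toNNReal_coe] at key
  have := congrArg (fun v => Complex.exp (c * (t : ℝ)) • v) key
  simpa [smul_smul, ← Complex.exp_add, T.op_zero] using this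

end C0Semigroup

/-! ### Gaussian series in Banach spaces -/

section GaussianSeries

open ProbabilityTheory ENNReal

/-- The law of a family of independent standard normal random variables. -/
noncomputable def gaussianNoise (ι : Type*) : Measure (ι → ℝ) :=
  Measure.infinitePi fun _ => gaussianReal 0 1

instance (ι : Type*) : IsProbabilityMeasure (gaussianNoise ι) := by
  unfold gaussianNoise; infer_instance

variable {ι : Type*}

theorem measurePreserving_eval_gaussianNoise (i : ι) :
    MeasurePreserving (fun ω : ι → ℝ => ω i) (gaussianNoise ι) (gaussianReal 0 1) :=
  ⟨measurable_pi_apply i, Measure.infinitePi_map_eval _ i⟩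

theorem iIndepFun_eval_gaussianNoise : iIndepFun (fun (i : ι) (ω : ι → ℝ) => ω i)
    (gaussianNoise ι) :=
  iIndepFun_infinitePi (X := fun _ x => x) (fun _ => measurable_id)

theorem lintegral_enorm_gaussianReal_ne_top : ∫⁻ x, ‖x‖ₑ ∂(gaussianReal 0 1) ≠ ∞ := by
  have h : Integrable (fun x : ℝ => x) (gaussianReal 0 1) :=
    memLp_one_iff_integrable.1 (memLp_id_gaussianReal 1)
  exact h.2.ne

/-- The characteristic function of a finite linear combination of standard normal variables. -/
theorem integral_exp_sum_gaussianNoise (s : Finset ι) (c : ι → ℝ) :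
    ∫ ω, Complex.exp ((∑ i ∈ s, ω i * c i : ℝ) * Complex.I) ∂(gaussianNoise ι) =
      Complex.exp ((-(∑ i ∈ s, c i ^ 2) / 2 : ℝ)) := by
  have h := (iIndepFun_eval_gaussianNoise (ι := ι)).precomp (g := ((↑) : s → ι))
    Subtype.val_injective
  have h2 := h.integral_fun_prod_comp (f := fun (i : s) (x : ℝ) => Complex.exp (c i * x * Complex.I))
    (fun i => (measurable_pi_apply _).aemeasurable) (fun i => by fun_prop)
  have e1 : ∀ ω : ι → ℝ, Complex.exp ((∑ i ∈ s, ω i * c i : ℝ) * Complex.I) =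
      ∏ i : s, Complex.exp (c i * (ω i : ℝ) * Complex.I) := by
    intro ω
    rw [← Complex.exp_sum, ← Finset.sum_coe_sort s]
    congr 1
    push_cast
    rw [Finset.sum_mul]
    exact Finset.sum_congr rfl fun i _ => by ring
  simp_rw [e1]
  rw [h2]
  have e2 : ∀ i : s, ∫ ω, Complex.exp (c i * ((ω i : ℝ) : ℂ) * Complex.I) ∂(gaussianNoise ι) =
      Complex.exp (-(c i ^ 2 : ℝ) / 2) := by
    intro i
    have h3 := charFun_gaussianReal (μ := 0) (v := 1) (c i)
    rw [charFun_apply_real] at h3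
    rw [← (measurePreserving_eval_gaussianNoise (i : ι)).map_eq,
      integral_map (measurable_pi_apply _).aemeasurable (by fun_prop)] at h3
    rw [h3]
    congr 1
    push_cast
    simp [neg_div]
  rw [Finset.prod_congr rfl fun i _ => e2 i, ← Complex.exp_sum,
    Finset.sum_coe_sort s (fun i => (-(c i ^ 2 : ℝ) / 2 : ℂ))]
  congr 1
  push_cast
  rw [← Finset.sum_div, Finset.sum_neg_distrib]

theorem tsum_enorm_ne_top {X : Type*} [NormedAddCommGroup X] {v : ι → X}
    (hv : Summable fun i => ‖v i‖) : ∑' i, ‖v i‖ₑ ≠ ∞ := by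
  have := hv.tsum_ofReal_ne_top
  simpa only [ofReal_norm] using this

theorem lintegral_tsum_gaussianNoise {X : Type*} [NormedAddCommGroup X] {κ : Type*} [Countable κ]
    (j : κ → ι) (v : ι → X) :
    ∫⁻ ω, ∑' k, ‖ω (j k)‖ₑ * ‖v (j k)‖ₑ ∂(gaussianNoise ι) =
      (∫⁻ x, ‖x‖ₑ ∂(gaussianReal 0 1)) * ∑' k, ‖v (j k)‖ₑ := by
  have hm : ∀ k, Measurable fun ω : ι → ℝ => ‖ω (j k)‖ₑ := fun k =>
    (measurable_pi_apply _).enorm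
  rw [lintegral_tsum fun k => ((hm k).mul_const _).aemeasurable, ← ENNReal.tsum_mul_left]
  congr 1 with k
  rw [lintegral_mul_const _ (hm k), ← (measurePreserving_eval_gaussianNoise (j k)).lintegral_comp
    measurable_enorm]

variable {X : Type*} [NormedAddCommGroup X] [NormedSpace ℝ X]

/-- The series `∑ ωᵢ vᵢ`. -/
noncomputable def gaussianSeries (v : ι → X) (ω : ι → ℝ) : X := ∑' i, ω i • v i

theorem ae_summable_gaussianSeries [Countable ι] {v : ι → X} (hv : Summable fun i => ‖v i‖) :
    ∀ᵐ ω ∂(gaussianNoise ι), Summable fun i => ‖ω i • v i‖ := by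
  have h : ∫⁻ ω, ∑' i, ‖ω i‖ₑ * ‖v i‖ₑ ∂(gaussianNoise ι) ≠ ∞ := by
    rw [lintegral_tsum_gaussianNoise (fun i => i)]
    exact ENNReal.mul_ne_top lintegral_enorm_gaussianReal_ne_top (tsum_enorm_ne_top hv)
  filter_upwards [ae_lt_top (by fun_prop) h] with ω hω
  have := ENNReal.summable_toReal hω.ne
  refine this.congr fun i => ?_
  simp [norm_smul]

variable [CompleteSpace X] [SecondCountableTopology X] [MeasurableSpace X] [BorelSpace X]
  [Countable ι]

theorem aemeasurable_gaussianSeries {v : ι → X} (hv : Summable fun i => ‖v i‖) :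
    AEMeasurable (gaussianSeries v) (gaussianNoise ι) := by
  refine aemeasurable_of_tendsto_metrizable_ae (u := atTop)
    (f := fun (s : Finset ι) (ω : ι → ℝ) => ∑ i ∈ s, ω i • v i) (fun s => ?_) ?_
  · refine Measurable.aemeasurable ?_
    fun_prop
  · filter_upwards [ae_summable_gaussianSeries hv] with ω hω using hω.of_norm.hasSum

/-- The law of the series `∑ gᵢ vᵢ` with independent standard normal coefficients `gᵢ`. -/
noncomputable def gaussianLaw (v : ι → X) : Measure X := (gaussianNoise ι).map (gaussianSeries v)

theorem isProbabilityMeasure_gaussianLaw {v : ι → X} (hv : Summable fun i => ‖v i‖) :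
    IsProbabilityMeasure (gaussianLaw v) :=
  Measure.isProbabilityMeasure_map (aemeasurable_gaussianSeries hv)

theorem charFunDual_gaussianLaw {v : ι → X} (hv : Summable fun i => ‖v i‖) (l : X →L[ℝ] ℝ)
    {q : ℝ} (hq : HasSum (fun i => l (v i) ^ 2) q) :
    charFunDual (gaussianLaw v) l = Complex.exp ((-q / 2 : ℝ)) := by
  rw [charFunDual_apply, gaussianLaw, integral_map (aemeasurable_gaussianSeries hv) (by fun_prop)]
  have h1 : Tendsto (fun s : Finset ι => ∫ ω, Complex.exp ((∑ i ∈ s, ω i * l (v i) : ℝ) * Complex.I)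
      ∂(gaussianNoise ι)) atTop
      (𝓝 (∫ ω, Complex.exp (l (gaussianSeries v ω) * Complex.I) ∂(gaussianNoise ι))) := by
    refine tendsto_integral_filter_of_dominated_convergence (fun _ => 1) ?_ ?_
      (integrable_const _) ?_
    · refine .of_forall fun s => Measurable.aestronglyMeasurable ?_
      have h4 : Measurable fun ω : ι → ℝ => ∑ i ∈ s, ω i * l (v i) :=
        Finset.measurable_fun_sum s fun i _ => (measurable_pi_apply i).mul_const _
      fun_prop
    · exact .of_forall fun s => .of_forall fun ω => by rw [Complex.norm_exp_ofReal_mul_I]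
    · filter_upwards [ae_summable_gaussianSeries hv] with ω hω
      have h2 : HasSum (fun i => ω i * l (v i)) (l (gaussianSeries v ω)) := by
        simpa [gaussianSeries] using hω.of_norm.hasSum.mapL l
      have h3 : Continuous fun x : ℝ => Complex.exp (x * Complex.I) := by fun_prop
      exact (h3.tendsto _).comp h2
  refine tendsto_nhds_unique h1 ?_
  simp_rw [integral_exp_sum_gaussianNoise]
  have h3 : Continuous fun x : ℝ => Complex.exp ((-x / 2 : ℝ)) := by fun_prop
  exact (h3.tendsto q).comp hq

/-- If the `vᵢ` span a dense subspace, then the law of `∑ gᵢ vᵢ` charges every open set: finitely many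
coefficients bring the partial sum close to a given finite linear combination, and independently of
them the remainder of the series is small with positive probability. -/
theorem gaussianLaw_pos_of_isOpen {v : ι → X} (hv : Summable fun i => ‖v i‖)
    (hd : Dense (Submodule.span ℝ (range v) : Set X)) {V : Set X} (hV : IsOpen V)
    (hne : V.Nonempty) : 0 < gaussianLaw v V := by
  classical
  obtain ⟨x, hxV, hx⟩ := hd.inter_open_nonempty V hV hne
  obtain ⟨ε, hε, hball⟩ := Metric.isOpen_iff.1 hV x hxV
  obtain ⟨c, hc⟩ := Finsupp.mem_span_range_iff_exists_finsupp.1 hx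
  -- the finite set of coefficients to be prescribed
  have htail : Tendsto (fun s : Finset ι => (∫⁻ x, ‖x‖ₑ ∂(gaussianReal 0 1)) *
      ∑' i : { i // i ∉ s }, ‖v i‖ₑ) atTop (𝓝 0) := by
    simpa using ENNReal.Tendsto.const_mul (ENNReal.tendsto_tsum_compl_atTop_zero
      (tsum_enorm_ne_top hv)) (Or.inr lintegral_enorm_gaussianReal_ne_top)
  have hε2 : (0 : ℝ≥0∞) < ENNReal.ofReal (ε / 2) := by simpa using hε
  obtain ⟨s, hs⟩ := ((htail.eventually (gt_mem_nhds hε2)).and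
    (eventually_ge_atTop c.support)).exists
  obtain ⟨hs, hcs⟩ := hs
  set δ : ℝ := ε / (2 * (∑ i ∈ s, ‖v i‖ + 1)) with hδ
  have hS : 0 ≤ ∑ i ∈ s, ‖v i‖ := Finset.sum_nonneg fun _ _ => norm_nonneg _
  have hδ0 : 0 < δ := by positivity
  set A : Set (ι → ℝ) := {ω | ∑' i : { i // i ∉ s }, ‖ω i‖ₑ * ‖v i‖ₑ < ENNReal.ofReal (ε / 2)}
  set B : Set (ι → ℝ) := (s : Set ι).pi fun i => Metric.ball (c i) δ
  have hmeas : ∀ i, Measurable fun ω : ι → ℝ => ‖ω i‖ₑ * ‖v i‖ₑ := fun i =>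
    (measurable_pi_apply i).enorm.mul_const _
  have hA : 0 < gaussianNoise ι A := by
    rw [pos_iff_ne_zero]
    intro h0
    have hAm : MeasurableSet A :=
      measurableSet_lt (Measurable.tsum fun i => hmeas i) measurable_const
    have h1 := (prob_compl_eq_one_iff hAm).2 h0
    have h2 := mul_meas_ge_le_lintegral (μ := gaussianNoise ι)
      (f := fun ω : ι → ℝ => ∑' i : { i // i ∉ s }, ‖ω i‖ₑ * ‖v i‖ₑ)
      (Measurable.tsum fun i => hmeas i) (ENNReal.ofReal (ε / 2))
    have h3 : {ω : ι → ℝ | ENNReal.ofReal (ε / 2) ≤ ∑' i : { i // i ∉ s }, ‖ω i‖ₑ * ‖v i‖ₑ} = Aᶜ := by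
      ext ω; simp [A]
    rw [h3, h1, mul_one, lintegral_tsum_gaussianNoise (fun i : { i // i ∉ s } => (i : ι))] at h2
    exact absurd hs (not_lt.2 h2)
  have hB : 0 < gaussianNoise ι B := by
    rw [gaussianNoise, Measure.infinitePi_pi _ fun i _ => Metric.isOpen_ball.measurableSet,
      pos_iff_ne_zero, Finset.prod_ne_zero_iff]
    intro i _ h0
    have := gaussianReal_absolutelyContinuous' 0 (one_ne_zero (α := ℝ≥0)) h0
    exact (Metric.measure_ball_pos volume (c i) hδ0).ne' this
  have hAB : gaussianNoise ι (B ∩ A) = gaussianNoise ι B * gaussianNoise ι A := by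
    have hi := indep_iSup_of_disjoint (fun i => (measurable_pi_apply i).comap_le)
      (iIndepFun_eval_gaussianNoise (ι := ι)).iIndep
      (S := (s : Set ι)) (T := (s : Set ι)ᶜ) disjoint_compl_right
    have hm : ∀ (S : Set ι) (i : ι), i ∈ S →
        Measurable[⨆ i ∈ S, MeasurableSpace.comap (fun ω : ι → ℝ => ω i) inferInstance]
          (fun ω : ι → ℝ => ω i) := fun S i hi =>
      (comap_measurable _).mono (le_iSup₂ (f := fun (i : ι) (_ : i ∈ S) =>
        MeasurableSpace.comap (fun ω : ι → ℝ => ω i) inferInstance) i hi) le_rfl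
    have hBm : ∀ {m : MeasurableSpace (ι → ℝ)}, (∀ i ∈ s, Measurable[m] fun ω : ι → ℝ => ω i) →
        MeasurableSet[m] B := by
      intro m h
      have e : B = ⋂ i ∈ s, (fun ω : ι → ℝ => ω i) ⁻¹' Metric.ball (c i) δ := by
        ext ω; simp [B]
      rw [e]
      exact s.measurableSet_biInter fun i hi => h i hi Metric.isOpen_ball.measurableSet
    have hAm : ∀ {m : MeasurableSpace (ι → ℝ)},
        (∀ i ∉ s, Measurable[m] fun ω : ι → ℝ => ω i) → MeasurableSet[m] A := by
      intro m h
      exact measurableSet_lt (Measurable.tsum fun i => (h i i.2).enorm.mul_const _) measurable_const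
    exact (Indep_iff _ _ _).1 hi B A (hBm fun i hi => hm _ i hi) (hAm fun i hi => hm _ i hi)
  have hsub : ∀ᵐ ω ∂(gaussianNoise ι), ω ∈ B ∩ A → gaussianSeries v ω ∈ V := by
    filter_upwards [ae_summable_gaussianSeries hv] with ω hω ⟨hωB, hωA⟩
    refine hball ?_
    have e1 : gaussianSeries v ω - x =
        ∑ i ∈ s, (ω i - c i) • v i + ∑' i : { i // i ∉ s }, ω i • v i := by
      rw [gaussianSeries, ← hω.of_norm.sum_add_tsum_subtype_compl s, ← hc,
        Finsupp.sum_of_support_subset c hcs _ (by simp)]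
      simp only [sub_smul, Finset.sum_sub_distrib]
      abel
    have e2 : ‖∑ i ∈ s, (ω i - c i) • v i‖ ≤ δ * ∑ i ∈ s, ‖v i‖ := by
      rw [Finset.mul_sum]
      refine (norm_sum_le _ _).trans (Finset.sum_le_sum fun i hi => ?_)
      rw [norm_smul]
      gcongr
      have := hωB i hi
      rw [Metric.mem_ball, dist_eq_norm] at this
      exact this.le
    have e3 : ‖∑' i : { i // i ∉ s }, ω i • v i‖ < ε / 2 := by
      have h1 : Summable fun i : { i // i ∉ s } => ‖ω i • v i‖ := hω.subtype _
      refine (norm_tsum_le_tsum_norm h1).trans_lt ?_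
      rw [← ENNReal.ofReal_lt_ofReal_iff (by positivity),
        ENNReal.ofReal_tsum_of_nonneg (fun _ => norm_nonneg _) h1]
      simp only [norm_smul, ENNReal.ofReal_mul (norm_nonneg _), ofReal_norm]
      exact hωA
    have e4 : δ * ∑ i ∈ s, ‖v i‖ ≤ ε / 2 := by
      rw [hδ, div_mul_eq_mul_div, div_le_div_iff₀ (by positivity) (by positivity)]
      nlinarith
    rw [Metric.mem_ball, dist_eq_norm, e1]
    linarith [norm_add_le (∑ i ∈ s, (ω i - c i) • v i) (∑' i : { i // i ∉ s }, ω i • v i)]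
  rw [gaussianLaw, Measure.map_apply_of_aemeasurable (aemeasurable_gaussianSeries hv)
    hV.measurableSet]
  exact (hAB ▸ ENNReal.mul_pos hB.ne' hA.ne').trans_le (measure_mono_ae hsub)

end GaussianSeries

/-! ### Strong mixing from characteristic functions -/

section Mixing

open ENNReal

variable {X : Type*} [NormedAddCommGroup X] [NormedSpace ℝ X] [MeasurableSpace X] [BorelSpace X]

theorem memLp_exp_dual (μ : Measure X) [IsFiniteMeasure μ] [SecondCountableTopology X]
    (l : X →L[ℝ] ℝ) :
    MemLp (fun x => Complex.exp (l x * Complex.I)) 2 μ :=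
  MemLp.of_bound (by fun_prop) 1 (.of_forall fun x => by rw [Complex.norm_exp_ofReal_mul_I])

/-- The function `x ↦ exp (i l x)` as an element of `L²(μ)`. -/
noncomputable def expLp (μ : Measure X) [IsFiniteMeasure μ] [SecondCountableTopology X]
    (l : X →L[ℝ] ℝ) : Lp ℂ 2 μ := (memLp_exp_dual μ l).toLp

variable [CompleteSpace X] [SecondCountableTopology X]

theorem ae_eq_zero_of_integral_exp_dual_mul_eq_zero {μ : Measure X} [IsFiniteMeasure μ] {g : X → ℝ}
    (hg : Integrable g μ)
    (h : ∀ l : X →L[ℝ] ℝ, ∫ x, Complex.exp (l x * Complex.I) * g x ∂μ = 0) : g =ᵐ[μ] 0 := by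
  have hgn : Integrable (fun x => -g x) μ := hg.neg
  have hfin : ∀ {f : X → ℝ}, Integrable f μ →
      IsFiniteMeasure (μ.withDensity fun x => ENNReal.ofReal (f x)) := fun hf =>
    isFiniteMeasure_withDensity_ofReal hf.2
  have := hfin hg
  have := hfin hgn
  have hint : ∀ {f : X → ℝ}, Integrable f μ → ∀ l : X →L[ℝ] ℝ,
      charFunDual (μ.withDensity fun x => ENNReal.ofReal (f x)) l =
        ∫ x, Complex.exp (l x * Complex.I) * (max (f x) 0 : ℝ) ∂μ := by
    intro f hf l
    rw [charFunDual_apply, integral_withDensity_eq_integral_toReal_smul₀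
      hf.1.aemeasurable.ennreal_ofReal (.of_forall fun _ => ofReal_lt_top)]
    refine integral_congr_ae (.of_forall fun x => ?_)
    simp only [ENNReal.toReal_ofReal', Complex.real_smul]
    ring
  have hmul : ∀ {f : X → ℝ}, Integrable f μ → ∀ l : X →L[ℝ] ℝ,
      Integrable (fun x => Complex.exp (l x * Complex.I) * (max (f x) 0 : ℝ)) μ := by
    intro f hf l
    refine (hf.pos_part.ofReal (𝕜 := ℂ)).bdd_mul (c := 1) (by fun_prop) (.of_forall fun x => ?_)
    rw [Complex.norm_exp_ofReal_mul_I]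
  have heq : (μ.withDensity fun x => ENNReal.ofReal (g x)) =
      μ.withDensity fun x => ENNReal.ofReal (-g x) := by
    refine Measure.ext_of_charFunDual (funext fun l => ?_)
    rw [hint hg, hint hgn, ← sub_eq_zero, ← integral_sub (hmul hg l) (hmul hgn l), ← h l]
    refine integral_congr_ae (.of_forall fun x => ?_)
    simp only [← mul_sub, ← Complex.ofReal_sub]
    congr 2
    rcases le_total (g x) 0 with h0 | h0
    · simp [h0]
    · simp [h0]
  have := (withDensity_eq_iff hg.1.aemeasurable.ennreal_ofReal
    hgn.1.aemeasurable.ennreal_ofReal (by simpa using hg.lintegral_lt_top.ne)).1 heq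
  filter_upwards [this] with x hx
  rcases le_total (g x) 0 with h0 | h0
  · rw [ENNReal.ofReal_of_nonpos h0] at hx
    have := ENNReal.ofReal_eq_zero.1 hx.symm
    exact le_antisymm h0 (by simpa using this)
  · rw [ENNReal.ofReal_of_nonpos (by simpa using h0 : -g x ≤ 0)] at hx
    exact le_antisymm (ENNReal.ofReal_eq_zero.1 hx) h0

/-- The exponentials of the real functionals span a dense subspace of `L²(μ)`, because finite measures
are determined by their characteristic functions. -/
theorem dense_span_expLp (μ : Measure X) [IsFiniteMeasure μ] :
    Dense (Submodule.span ℂ (range (expLp μ)) : Set (Lp ℂ 2 μ)) := by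
  rw [Submodule.dense_iff_topologicalClosure_eq_top, Submodule.topologicalClosure_eq_top_iff,
    Submodule.eq_bot_iff]
  intro g hg
  have hgi : Integrable g μ := (Lp.memLp g).integrable (by norm_num)
  have h0 : ∀ l : X →L[ℝ] ℝ, ∫ x, Complex.exp (l x * Complex.I) * g x ∂μ = 0 := by
    intro l
    have := (Submodule.mem_orthogonal _ _).1 hg (expLp μ (-l))
      (Submodule.subset_span (mem_range_self _))
    rw [L2.inner_def] at this
    rw [← this]
    refine integral_congr_ae ?_
    filter_upwards [(memLp_exp_dual μ (-l)).coeFn_toLp] with x hx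
    rw [expLp, hx]
    simp [← Complex.exp_conj, mul_comm]
  have hmul : ∀ {f : X → ℂ}, Integrable f μ → ∀ l : X →L[ℝ] ℝ,
      Integrable (fun x => Complex.exp (l x * Complex.I) * f x) μ := fun hf l =>
    hf.bdd_mul (c := 1) (by fun_prop)
      (.of_forall fun x => by rw [Complex.norm_exp_ofReal_mul_I])
  have h1 : ∀ l : X →L[ℝ] ℝ,
      ∫ x, Complex.exp (l x * Complex.I) * (starRingEnd ℂ) (g x) ∂μ = 0 := by
    intro l
    have := congrArg (starRingEnd ℂ) (h0 (-l))
    rw [← integral_conj] at this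
    simpa [← Complex.exp_conj] using this
  have hconj : Integrable (fun x => (starRingEnd ℂ) (g x)) μ :=
    Complex.conjLIE.toContinuousLinearEquiv.toContinuousLinearMap.integrable_comp hgi
  have hre : (fun x => (g x).re) =ᵐ[μ] 0 := by
    refine ae_eq_zero_of_integral_exp_dual_mul_eq_zero hgi.re fun l => ?_
    have := integral_add (hmul hgi l) (hmul hconj l)
    rw [h0, h1, add_zero] at this
    have h2 : ∫ x, 2 * (Complex.exp (l x * Complex.I) * ((g x).re : ℂ)) ∂μ = 0 := by
      rw [← this]
      refine integral_congr_ae (.of_forall fun x => ?_)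
      simp only [← mul_add, Complex.add_conj]
      push_cast; ring
    rw [integral_const_mul] at h2
    simpa using h2
  have him : (fun x => (g x).im) =ᵐ[μ] 0 := by
    refine ae_eq_zero_of_integral_exp_dual_mul_eq_zero hgi.im fun l => ?_
    have := integral_sub (hmul hgi l) (hmul hconj l)
    rw [h0, h1, sub_zero] at this
    have h2 : ∫ x, (2 * Complex.I) * (Complex.exp (l x * Complex.I) * ((g x).im : ℂ)) ∂μ = 0 := by
      rw [← this]
      refine integral_congr_ae (.of_forall fun x => ?_)
      simp only [← mul_sub, Complex.sub_conj]
      push_cast; ring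
    rw [integral_const_mul] at h2
    simpa using h2
  rw [Lp.eq_zero_iff_ae_eq_zero]
  filter_upwards [hre, him] with x h1 h2
  exact Complex.ext h1 h2

/-- A measure preserving family of operators is strongly mixing as soon as the joint characteristic
functions of `(x, P t x)` converge to those of the product measure. -/
theorem tendsto_measure_inter_preimage_of_charFunDual {μ : Measure X} [IsProbabilityMeasure μ]
    {ι : Type*} {f : Filter ι} {P : ι → X →L[ℝ] X} (hP : ∀ t, MeasurePreserving (P t) μ μ)
    (h : ∀ l m : X →L[ℝ] ℝ, Tendsto (fun t => charFunDual μ (l + m.comp (P t))) f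
      (𝓝 (charFunDual μ l * charFunDual μ m)))
    {B C : Set X} (hB : MeasurableSet B) (hC : MeasurableSet C) :
    Tendsto (fun t => μ (B ∩ P t ⁻¹' C)) f (𝓝 (μ B * μ C)) := by
  -- the Koopman operators and the function `1` in `L²(μ)`
  let U : ι → Lp ℂ 2 μ →L[ℂ] Lp ℂ 2 μ := fun t =>
    (Lp.compMeasurePreservingₗᵢ ℂ (P t) (hP t)).toContinuousLinearMap
  let one : Lp ℂ 2 μ := expLp μ 0
  have hU : ∀ t, ‖U t‖ ≤ 1 := fun t => LinearIsometry.norm_toContinuousLinearMap_le _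
  have hexp : ∀ l m : X →L[ℝ] ℝ, inner ℂ (expLp μ l) (expLp μ m) = charFunDual μ (m - l) := by
    intro l m
    rw [L2.inner_def, charFunDual_apply]
    refine integral_congr_ae ?_
    filter_upwards [(memLp_exp_dual μ l).coeFn_toLp, (memLp_exp_dual μ m).coeFn_toLp] with x h1 h2
    rw [expLp, expLp, h1, h2]
    simp only [RCLike.inner_apply, ← Complex.exp_conj, ← Complex.exp_add]
    congr 1
    simp
    ring
  have hUexp : ∀ t (m : X →L[ℝ] ℝ), U t (expLp μ m) = expLp μ (m.comp (P t)) := fun t m => rfl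
  have key1 : ∀ l m : X →L[ℝ] ℝ, Tendsto (fun t => inner ℂ (expLp μ l) (U t (expLp μ m))) f
      (𝓝 (inner ℂ (expLp μ l) one * inner ℂ one (expLp μ m))) := by
    intro l m
    simp only [hUexp, hexp, one, zero_sub, sub_zero]
    simpa [sub_eq_add_neg, add_comm] using h (-l) m
  have key2 : ∀ (l : X →L[ℝ] ℝ) (G : Lp ℂ 2 μ), Tendsto (fun t => inner ℂ (expLp μ l) (U t G)) f
      (𝓝 (inner ℂ (expLp μ l) one * inner ℂ one G)) := by
    intro l G
    refine tendsto_clm_apply_of_dense_span (P := fun t => (innerSL ℂ (expLp μ l)).comp (U t))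
      (Q := (inner ℂ (expLp μ l) one) • innerSL ℂ one) (M := ‖expLp μ l‖) ?_ (dense_span_expLp μ)
      ?_ G
    · refine .of_forall fun t => (ContinuousLinearMap.opNorm_comp_le _ _).trans ?_
      rw [innerSL_apply_norm]
      exact mul_le_of_le_one_right (norm_nonneg _) (hU t)
    · rintro _ ⟨m, rfl⟩
      exact key1 l m
  have key3 : ∀ F G : Lp ℂ 2 μ, Tendsto (fun t => inner ℂ (U t G) F) f
      (𝓝 (inner ℂ G one * inner ℂ one F)) := by
    intro F G
    refine tendsto_clm_apply_of_dense_span (P := fun t => innerSL ℂ (U t G))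
      (Q := (inner ℂ G one) • innerSL ℂ one) (M := ‖G‖) ?_ (dense_span_expLp μ) ?_ F
    · refine .of_forall fun t => ?_
      rw [innerSL_apply_norm]
      exact ((U t).le_of_opNorm_le (hU t) G).trans_eq (one_mul _)
    · rintro _ ⟨l, rfl⟩
      have := (Complex.continuous_conj.tendsto _).comp (key2 l G)
      simpa [Function.comp_def, inner_conj_symm, mul_comm] using this
  have hone : one = indicatorConstLp 2 MeasurableSet.univ (measure_ne_top μ _) (1 : ℂ) := by
    rw [Lp.ext_iff]
    filter_upwards [(memLp_exp_dual μ 0).coeFn_toLp, indicatorConstLp_coeFn (p := 2) (μ := μ)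
      (hs := MeasurableSet.univ) (hμs := measure_ne_top μ _) (c := (1 : ℂ))] with x h1 h2
    rw [h2]
    simp only [one, expLp]
    rw [h1]
    simp
  have key := key3 (indicatorConstLp 2 hB (measure_ne_top μ _) (1 : ℂ))
    (indicatorConstLp 2 hC (measure_ne_top μ _) (1 : ℂ))
  rw [hone] at key
  have hU1 : ∀ t, U t (indicatorConstLp 2 hC (measure_ne_top μ _) (1 : ℂ)) =
      indicatorConstLp 2 (hC.preimage (hP t).measurable) (measure_ne_top μ _) (1 : ℂ) := fun t => rfl
  simp only [hU1, L2.inner_indicatorConstLp_one_indicatorConstLp_one, inter_univ, univ_inter] at key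
  have key4 : Tendsto (fun t => μ.real (B ∩ P t ⁻¹' C)) f (𝓝 (μ.real B * μ.real C)) := by
    have := (Complex.continuous_re.tendsto _).comp key
    simpa [Function.comp_def, inter_comm, mul_comm] using this
  have key5 := (ENNReal.tendsto_ofReal key4)
  simpa [ENNReal.ofReal_mul, measureReal_nonneg] using key5

end Mixing

/-! ### Invariant measures from fields of imaginary eigenvectors -/

section Eigenfield

variable {X : Type*} [NormedAddCommGroup X] [NormedSpace ℂ X]

theorem norm_extendRCLike_sq (l : X →L[ℝ] ℝ) (x : X) :
    ‖(StrongDual.extendRCLike l : X →L[ℂ] ℂ) x‖ ^ 2 = l x ^ 2 + l (Complex.I • x) ^ 2 := by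
  rw [← Complex.normSq_eq_norm_sq, Complex.normSq_apply]
  have : (StrongDual.extendRCLike l : X →L[ℂ] ℂ) x = l x - Complex.I * l (Complex.I • x) := rfl
  rw [this]
  simp
  ring

theorem extendRCLike_comp_restrictScalars_apply (l : X →L[ℝ] ℝ) (P : X →L[ℂ] X) (x : X) :
    (StrongDual.extendRCLike (l.comp (P.restrictScalars ℝ)) : X →L[ℂ] ℂ) x =
      (StrongDual.extendRCLike l : X →L[ℂ] ℂ) (P x) := by
  change ((l (P x) : ℝ) : ℂ) - Complex.I * (l (P (Complex.I • x)) : ℝ) =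
    ((l (P x) : ℝ) : ℂ) - Complex.I * (l (Complex.I • P x) : ℝ)
  rw [map_smul]

theorem extendRCLike_add_apply (l m : X →L[ℝ] ℝ) (x : X) :
    (StrongDual.extendRCLike (l + m) : X →L[ℂ] ℂ) x =
      (StrongDual.extendRCLike l : X →L[ℂ] ℂ) x + (StrongDual.extendRCLike m : X →L[ℂ] ℂ) x := by
  change (((l x + m x : ℝ) : ℂ) - Complex.I * (l (Complex.I • x) + m (Complex.I • x) : ℝ)) =
    (((l x : ℝ) : ℂ) - Complex.I * (l (Complex.I • x) : ℝ)) +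
    (((m x : ℝ) : ℂ) - Complex.I * (m (Complex.I • x) : ℝ))
  push_cast
  ring

/-- The coefficient vectors `eₙ` and `i eₙ` of a Fourier series `∑ eₙ`, as a family over the reals. -/
noncomputable def realFourierFamily {a b : ℝ} (hab : a < b) (F : ℝ → X) : ℤ × Bool → X :=
  fun p => if p.2 then Complex.I • fourierCoeffOn hab F p.1 else fourierCoeffOn hab F p.1

theorem summable_norm_realFourierFamily {a b : ℝ} (hab : a < b) {F : ℝ → X}
    (h : Summable fun n : ℤ => ‖fourierCoeffOn hab F n‖) :
    Summable fun p => ‖realFourierFamily hab F p‖ := by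
  refine (summable_prod_of_nonneg fun _ => norm_nonneg _).2 ⟨fun n => Summable.of_finite, ?_⟩
  refine (h.mul_left 2).congr fun n => ?_
  simp [realFourierFamily, norm_smul, two_mul]

variable [CompleteSpace X]

theorem clm_apply_fourierCoeffOn {a b : ℝ} (hab : a < b) {F : ℝ → X} (hF : ContinuousOn F (Icc a b))
    (φ : X →L[ℂ] ℂ) (n : ℤ) : φ (fourierCoeffOn hab F n) = fourierCoeffOn hab (fun x => φ (F x)) n := by
  rw [fourierCoeffOn_eq_integral, fourierCoeffOn_eq_integral,
    φ.map_smul_of_tower]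
  congr 1
  rw [← φ.intervalIntegral_comp_comm]
  · simp
  · refine ContinuousOn.intervalIntegrable ?_
    rw [uIcc_of_le hab.le]
    refine ContinuousOn.smul (Continuous.continuousOn ?_) hF
    fun_prop

/-- The Fourier coefficients of a `C²` function that vanishes at both ends of the interval decay
quadratically, so that they are absolutely summable. -/
theorem summable_norm_fourierCoeffOn {a b : ℝ} (hab : a < b) {F F' F'' : ℝ → X}
    (hF : ∀ x ∈ Icc a b, HasDerivAt F (F' x) x) (hF' : ∀ x ∈ Icc a b, HasDerivAt F' (F'' x) x)
    (hF'' : ContinuousOn F'' (Icc a b)) (ha : F a = 0) (hb : F b = 0) :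
    Summable fun n : ℤ => ‖fourierCoeffOn hab F n‖ := by
  have hu : uIcc a b = Icc a b := uIcc_of_le hab.le
  have hFc : ContinuousOn F (Icc a b) := fun x hx => (hF x hx).continuousAt.continuousWithinAt
  have hFc' : ContinuousOn F' (Icc a b) := fun x hx => (hF' x hx).continuousAt.continuousWithinAt
  obtain ⟨C, hC⟩ := isCompact_Icc.exists_bound_of_continuousOn hF''
  set D : ℝ := (b - a) / (2 * Real.pi) ^ 2 * (‖F' b - F' a‖ + (b - a) * C) with hD
  have hba : 0 < b - a := sub_pos.2 hab
  have key : ∀ n : ℤ, n ≠ 0 → ‖fourierCoeffOn hab F n‖ ≤ D * (1 / (n : ℝ) ^ 2) := by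
    intro n hn
    obtain ⟨φ, hφ, hφ'⟩ := exists_dual_vector'' ℂ (fourierCoeffOn hab F n)
    have h1 := fourierCoeffOn_of_hasDerivAt hab hn (f := fun x => φ (F x)) (f' := fun x => φ (F' x))
      (fun x hx => φ.restrictScalars ℝ |>.hasFDerivAt.comp_hasDerivAt x (hF x (hu ▸ hx)))
      (ContinuousOn.intervalIntegrable (hu ▸ φ.continuous.comp_continuousOn hFc'))
    have h2 := fourierCoeffOn_of_hasDerivAt hab hn (f := fun x => φ (F' x))
      (f' := fun x => φ (F'' x))
      (fun x hx => φ.restrictScalars ℝ |>.hasFDerivAt.comp_hasDerivAt x (hF' x (hu ▸ hx)))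
      (ContinuousOn.intervalIntegrable (hu ▸ φ.continuous.comp_continuousOn hF''))
    have h3 : ‖fourierCoeffOn hab (fun x => φ (F'' x)) n‖ ≤ C := by
      rw [fourierCoeffOn_eq_integral, norm_smul, Real.norm_of_nonneg (by positivity)]
      have := intervalIntegral.norm_integral_le_of_norm_le_const (a := a) (b := b) (C := C)
        (f := fun x => fourier (-n) (x : AddCircle (b - a)) • φ (F'' x)) (fun x hx => by
          rw [uIoc_of_le hab.le] at hx
          rw [norm_smul, fourier_apply, Circle.norm_coe, one_mul]
          exact (φ.le_of_opNorm_le hφ _).trans (by simpa using hC x ⟨hx.1.le, hx.2⟩))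
      rw [abs_of_pos hba] at this
      calc _ ≤ 1 / (b - a) * (C * (b - a)) := by gcongr
        _ = C := by field_simp
    have h4 : ‖fourierCoeffOn hab F n‖ = ‖fourierCoeffOn hab (fun x => φ (F x)) n‖ := by
      rw [← clm_apply_fourierCoeffOn hab hFc, hφ']; simp
    have h5 : ‖(1 / (-2 * Real.pi * Complex.I * n) : ℂ)‖ = 1 / (2 * Real.pi * |(n : ℝ)|) := by
      simp [abs_of_pos Real.pi_pos]
    have h6 : ‖fourierCoeffOn hab (fun x => φ (F' x)) n‖ ≤ 1 / (2 * Real.pi * |(n : ℝ)|) *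
        (‖F' b - F' a‖ + (b - a) * C) := by
      rw [h2, norm_mul, h5]
      gcongr
      refine (norm_sub_le _ _).trans (add_le_add ?_ ?_)
      · rw [norm_mul, fourier_apply, Circle.norm_coe, one_mul, ← map_sub]
        exact (φ.le_of_opNorm_le hφ _).trans_eq (one_mul _)
      · rw [norm_mul, ← Complex.ofReal_sub, Complex.norm_real, Real.norm_of_nonneg hba.le]
        gcongr
    rw [h4, h1, ha, hb, norm_mul, h5]
    simp only [map_zero, sub_zero, mul_zero, zero_sub, norm_neg]
    rw [norm_mul, ← Complex.ofReal_sub, Complex.norm_real, Real.norm_of_nonneg hba.le]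
    calc _ ≤ 1 / (2 * Real.pi * |(n : ℝ)|) * ((b - a) * (1 / (2 * Real.pi * |(n : ℝ)|) *
        (‖F' b - F' a‖ + (b - a) * C))) := by gcongr
      _ = D * (1 / (n : ℝ) ^ 2) := by
        rw [hD, ← sq_abs (n : ℝ)]
        have : |(n : ℝ)| ≠ 0 := by simpa using hn
        field_simp
  refine Summable.of_norm_bounded_eventually
    (g := fun n : ℤ => D * (1 / (n : ℝ) ^ 2)) ?_ ?_
  · exact (Real.summable_one_div_int_pow.2 one_lt_two).mul_left D
  · filter_upwards [(finite_singleton (0 : ℤ)).compl_mem_cofinite] with n hn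
    simpa using key n hn

/-- The covariance of the Gaussian series is computed by Parseval's identity. -/
theorem hasSum_sq_realFourierFamily {a b : ℝ} (hab : a < b) {F : ℝ → X}
    (hF : ContinuousOn F (Icc a b)) (l : X →L[ℝ] ℝ) :
    HasSum (fun p => l (realFourierFamily hab F p) ^ 2)
      ((b - a)⁻¹ * ∫ x in a..b, ‖(StrongDual.extendRCLike l : X →L[ℂ] ℂ) (F x)‖ ^ 2) := by
  set φ : X →L[ℂ] ℂ := StrongDual.extendRCLike l with hφ
  have hc : ContinuousOn (fun x => φ (F x)) (Icc a b) := φ.continuous.comp_continuousOn hF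
  obtain ⟨C, hC⟩ := isCompact_Icc.exists_bound_of_continuousOn hc
  have hL2 : MemLp (fun x => φ (F x)) 2 (volume.restrict (Ioc a b)) :=
    MemLp.of_bound ((hc.mono Ioc_subset_Icc_self).aestronglyMeasurable measurableSet_Ioc) C
      ((ae_restrict_iff' measurableSet_Ioc).2 (.of_forall fun x hx => hC x ⟨hx.1.le, hx.2⟩))
  have h1 := hasSum_sq_fourierCoeffOn hab hL2
  have h2 : ∀ n : ℤ, HasSum (fun c : Bool => l (realFourierFamily hab F (n, c)) ^ 2)
      (‖fourierCoeffOn hab (fun x => φ (F x)) n‖ ^ 2) := by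
    intro n
    rw [← clm_apply_fourierCoeffOn hab hF, hφ, norm_extendRCLike_sq]
    convert hasSum_fintype (fun c : Bool => l (realFourierFamily hab F (n, c)) ^ 2) using 1
    simp [realFourierFamily, add_comm]
  have h3 : Summable fun p => l (realFourierFamily hab F p) ^ 2 :=
    (summable_prod_of_nonneg fun _ => sq_nonneg _).2
      ⟨fun n => (h2 n).summable, h1.summable.congr fun n => (h2 n).tsum_eq.symm⟩
  have h4 := h3.hasSum.prod_fiberwise h2
  rw [← smul_eq_mul, h1.unique h4]
  exact h3.hasSum

variable [SecondCountableTopology X] [MeasurableSpace X] [BorelSpace X]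

/-- A `C₀`-semigroup with a total `C²` field of imaginary eigenvectors `T_t F(θ) = exp(i θ t) F(θ)`,
vanishing at the ends of the parameter interval, has a strongly mixing invariant probability measure of
full support: the law of the stochastic integral `∫ F dW` with respect to a complex white noise `W`. The
semigroup only rotates the noise, which gives invariance, and the correlation between times `0` and
`t` is the Fourier transform of an integrable function, so it vanishes as `t → ∞`. -/
theorem exists_isInvariantMixingFullSupport (T : C0Semigroup X) {a b : ℝ} (hab : a < b)
    {F F' F'' : ℝ → X} (hF : ∀ x ∈ Icc a b, HasDerivAt F (F' x) x)
    (hF' : ∀ x ∈ Icc a b, HasDerivAt F' (F'' x) x) (hF'' : ContinuousOn F'' (Icc a b))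
    (ha : F a = 0) (hb : F b = 0)
    (heig : ∀ x ∈ Icc a b, ∀ t : ℝ≥0, T.op t (F x) = Complex.exp ((x * t : ℝ) * Complex.I) • F x)
    (htotal : ∀ φ : X →L[ℂ] ℂ, (∀ x ∈ Icc a b, φ (F x) = 0) → φ = 0) :
    ∃ μ : Measure X, IsInvariantMixingFullSupport T μ := by
  have hFc : ContinuousOn F (Icc a b) := fun x hx => (hF x hx).continuousAt.continuousWithinAt
  set v := realFourierFamily hab F
  have hv : Summable fun p => ‖v p‖ :=
    summable_norm_realFourierFamily hab (summable_norm_fourierCoeffOn hab hF hF' hF'' ha hb)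
  set μ := gaussianLaw v
  have hμ : IsProbabilityMeasure μ := isProbabilityMeasure_gaussianLaw hv
  let Φ : (X →L[ℝ] ℝ) → X →L[ℂ] ℂ := fun l => StrongDual.extendRCLike l
  have hΦc : ∀ l, ContinuousOn (fun x => Φ l (F x)) (Icc a b) := fun l =>
    (Φ l).continuous.comp_continuousOn hFc
  have hchar : ∀ l : X →L[ℝ] ℝ, charFunDual μ l =
      Complex.exp ((-((b - a)⁻¹ * ∫ x in a..b, ‖Φ l (F x)‖ ^ 2) / 2 : ℝ)) := fun l =>
    charFunDual_gaussianLaw hv l (hasSum_sq_realFourierFamily hab hFc l)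
  let P : ℝ≥0 → X →L[ℝ] X := fun t => (T.op t).restrictScalars ℝ
  have hΦP : ∀ l (t : ℝ≥0), ∀ x ∈ Icc a b, Φ (l.comp (P t)) (F x) =
      Complex.exp ((x * t : ℝ) * Complex.I) * Φ l (F x) := by
    intro l t x hx
    simp only [Φ, P]
    rw [extendRCLike_comp_restrictScalars_apply, heig x hx, map_smul, smul_eq_mul]
  have hinv : ∀ t, μ.map (P t) = μ := by
    intro t
    have : IsFiniteMeasure (μ.map (P t)) := Measure.isFiniteMeasure_map _ _
    refine Measure.ext_of_charFunDual (funext fun l => ?_)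
    rw [charFunDual_map, hchar, hchar]
    congr 5
    refine intervalIntegral.integral_congr fun x hx => ?_
    rw [uIcc_of_le hab.le] at hx
    rw [hΦP l t x hx, norm_mul, Complex.norm_exp_ofReal_mul_I, one_mul]
  have hmp : ∀ t, MeasurePreserving (P t) μ μ := fun t => ⟨(P t).continuous.measurable, hinv t⟩
  have hdense : Dense (Submodule.span ℝ (range v) : Set X) := by
    refine dense_span_of_forall_dual fun l hl => ?_
    have h1 := hasSum_sq_realFourierFamily hab hFc l
    have h2 : (b - a)⁻¹ * ∫ x in a..b, ‖Φ l (F x)‖ ^ 2 = 0 := by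
      refine h1.unique ?_
      have : (fun p => l (realFourierFamily hab F p) ^ 2) = fun _ => 0 := by
        ext p
        rw [hl _ (mem_range_self p)]
        simp
      rw [this]
      exact hasSum_zero
    have h3 : Φ l = 0 := by
      refine htotal _ fun x hx => ?_
      by_contra hne
      have h4 := intervalIntegral.integral_pos hab ((hΦc l).norm.pow 2)
        (fun y _ => sq_nonneg _) ⟨x, hx, pow_pos (norm_pos_iff.2 hne) 2⟩
      have : 0 < (b - a)⁻¹ := inv_pos.2 (sub_pos.2 hab)
      exact (mul_pos this h4).ne' h2
    ext x
    have h4 := norm_extendRCLike_sq l x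
    have h5 : (StrongDual.extendRCLike l : X →L[ℂ] ℂ) x = 0 := DFunLike.congr_fun h3 x
    rw [h5] at h4
    have : l x ^ 2 = 0 := by
      have := sq_nonneg (l (Complex.I • x))
      have := sq_nonneg (l x)
      simp at h4
      linarith
    simpa using this
  refine ⟨μ, hμ, fun t B hB => (hmp t).measure_preimage hB.nullMeasurableSet, fun B C hB hC => ?_,
    fun V hV hne => gaussianLaw_pos_of_isOpen hv hdense hV hne⟩
  refine tendsto_measure_inter_preimage_of_charFunDual hmp (fun l m => ?_) hB hC
  -- the cross term is a Fourier transform, to which the Riemann–Lebesgue lemma applies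
  let g : ℝ → ℂ := fun x => (starRingEnd ℂ) (Φ l (F x)) * Φ m (F x)
  have hgc : ContinuousOn g (Icc a b) :=
    (Complex.continuous_conj.comp_continuousOn (hΦc l)).mul (hΦc m)
  have hec : ∀ t : ℝ≥0, Continuous fun x : ℝ => Complex.exp ((x * t : ℝ) * Complex.I) := by
    intro t; fun_prop
  have hRL : Tendsto (fun t : ℝ≥0 => ∫ x in a..b, Complex.exp ((x * t : ℝ) * Complex.I) * g x)
      atTop (𝓝 0) := by
    have h1 := Real.tendsto_integral_exp_smul_cocompact ((Ioc a b).indicator g)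
    have h2 : Tendsto (fun t : ℝ≥0 => -((t : ℝ) / (2 * Real.pi))) atTop (cocompact ℝ) := by
      refine Tendsto.mono_right ?_ atBot_le_cocompact
      exact tendsto_neg_atTop_atBot.comp
        (NNReal.tendsto_coe_atTop.2 tendsto_id |>.atTop_div_const (by positivity))
    refine (h1.comp h2).congr fun t => ?_
    simp only [Function.comp_apply]
    rw [intervalIntegral.integral_of_le hab.le, ← integral_indicator measurableSet_Ioc]
    refine integral_congr_ae (.of_forall fun x => ?_)
    by_cases hx : x ∈ Ioc a b
    · simp only [indicator_of_mem hx, Circle.smul_def, Real.fourierChar_apply, smul_eq_mul]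
      congr 3
      have := Real.pi_ne_zero
      field_simp
    · simp [indicator_of_notMem hx]
  have hsplit : ∀ t : ℝ≥0, (∫ x in a..b, ‖Φ (l + m.comp (P t)) (F x)‖ ^ 2) =
      (∫ x in a..b, ‖Φ l (F x)‖ ^ 2) + (∫ x in a..b, ‖Φ m (F x)‖ ^ 2) +
        2 * (∫ x in a..b, Complex.exp ((x * t : ℝ) * Complex.I) * g x).re := by
    intro t
    have hi : ∀ {f : ℝ → ℝ}, ContinuousOn f (Icc a b) → IntervalIntegrable f volume a b :=
      fun hf => ContinuousOn.intervalIntegrable (by rwa [uIcc_of_le hab.le])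
    have hcc : ContinuousOn (fun x : ℝ => Complex.exp ((x * t : ℝ) * Complex.I) * g x)
        (Icc a b) := (hec t).continuousOn.mul hgc
    have hre : (∫ x in a..b, Complex.exp ((x * t : ℝ) * Complex.I) * g x).re =
        ∫ x in a..b, (Complex.exp ((x * t : ℝ) * Complex.I) * g x).re := by
      have := Complex.reCLM.intervalIntegral_comp_comm (a := a) (b := b) (μ := volume)
        (f := fun x : ℝ => Complex.exp ((x * t : ℝ) * Complex.I) * g x)
        (ContinuousOn.intervalIntegrable (by rwa [uIcc_of_le hab.le]))
      simpa using this.symm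
    rw [hre, ← intervalIntegral.integral_const_mul, ← intervalIntegral.integral_add,
      ← intervalIntegral.integral_add]
    · refine intervalIntegral.integral_congr fun x hx => ?_
      rw [uIcc_of_le hab.le] at hx
      have h1 : Φ (l + m.comp (P t)) (F x) =
          Φ l (F x) + Complex.exp ((x * t : ℝ) * Complex.I) * Φ m (F x) := by
        rw [← hΦP m t x hx]
        exact extendRCLike_add_apply _ _ _
      rw [h1]
      simp only [← Complex.normSq_eq_norm_sq]
      rw [Complex.normSq_add, Complex.normSq_mul]
      have h2 : Complex.normSq (Complex.exp ((x * t : ℝ) * Complex.I)) = 1 := by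
        rw [Complex.normSq_eq_norm_sq, Complex.norm_exp_ofReal_mul_I]; norm_num
      rw [h2, one_mul]
      congr 2
      rw [← Complex.conj_re]
      simp only [g, map_mul, Complex.conj_conj]
      congr 1
      ring
    · exact hi (((hΦc l).norm.pow 2).add ((hΦc m).norm.pow 2))
    · exact hi (continuousOn_const.mul (Complex.continuous_re.comp_continuousOn hcc))
    · exact hi ((hΦc l).norm.pow 2)
    · exact hi ((hΦc m).norm.pow 2)
  simp only [hchar, hsplit]
  rw [← Complex.exp_add, ← Complex.ofReal_add]
  have hcont : Continuous fun z : ℂ => Complex.exp ((-((b - a)⁻¹ *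
      ((∫ x in a..b, ‖Φ l (F x)‖ ^ 2) + (∫ x in a..b, ‖Φ m (F x)‖ ^ 2) + 2 * z.re)) / 2 : ℝ)) := by
    fun_prop
  have h1 := (hcont.tendsto 0).comp hRL
  rw [Complex.zero_re] at h1
  refine (congrArg (fun z : ℝ => Tendsto _ _ (𝓝 (Complex.exp (z : ℂ)))) ?_).mp h1
  ring

end Eigenfield

/-! ### The space `Y^{s,τ}` in the logarithmic variable -/

namespace BSSpace

variable {s τ : ℝ}

/-- The point `exp y` of `(0, ∞)`. -/
noncomputable def expPt (y : ℝ) : Ioi (0 : ℝ) := ⟨Real.exp y, Real.exp_pos y⟩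

theorem expPt_log (x : Ioi (0 : ℝ)) : expPt (Real.log x) = x :=
  Subtype.ext (Real.exp_log x.2)

theorem continuous_expPt : Continuous expPt := Real.continuous_exp.subtype_mk _

/-- The function `y ↦ u (exp y)` on the real line. -/
noncomputable def logFun (u : BSSpace s τ) (y : ℝ) : ℂ := u (expPt y)

/-- The weight of `Y^{s,τ}` in the logarithmic variable. -/
noncomputable def logWeight (s τ y : ℝ) : ℝ := (1 + Real.exp (s * y)) * (1 + Real.exp (-τ * y))

theorem logWeight_pos (s τ y : ℝ) : 0 < logWeight s τ y := by
  unfold logWeight; positivity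

theorem bsWeight_expPt (s τ y : ℝ) : bsWeight s τ (expPt y) = logWeight s τ y := by
  simp only [bsWeight, logWeight, expPt, ← Real.exp_mul, mul_comm]

@[fun_prop]
theorem continuous_logWeight (s τ : ℝ) : Continuous (logWeight s τ) := by
  unfold logWeight; fun_prop

@[fun_prop]
theorem continuous_logFun (u : BSSpace s τ) : Continuous (logFun u) :=
  u.1.continuous.comp continuous_expPt

theorem val_eq_logFun (u : BSSpace s τ) (x : Ioi (0 : ℝ)) : u x = logFun u (Real.log x) := by
  rw [logFun, expPt_log]

theorem logFun_injective : Function.Injective (logFun : BSSpace s τ → ℝ → ℂ) := by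
  intro u v h
  refine Subtype.ext (ContinuousMap.ext fun x => ?_)
  have := congrFun h (Real.log x)
  rwa [← val_eq_logFun, ← val_eq_logFun] at this

@[simp] theorem logFun_add (u v : BSSpace s τ) (y : ℝ) : logFun (u + v) y = logFun u y + logFun v y :=
  rfl

@[simp] theorem logFun_sub (u v : BSSpace s τ) (y : ℝ) : logFun (u - v) y = logFun u y - logFun v y :=
  rfl

@[simp] theorem logFun_smul (c : ℂ) (u : BSSpace s τ) (y : ℝ) : logFun (c • u) y = c * logFun u y :=
  rfl

@[simp] theorem logFun_zero (y : ℝ) : logFun (0 : BSSpace s τ) y = 0 := rfl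

theorem norm_logFun_le (u : BSSpace s τ) (y : ℝ) : ‖logFun u y‖ ≤ ‖u‖ * logWeight s τ y := by
  have := le_ciSup u.bddAbove_range (expPt y)
  rwa [← norm_def, div_le_iff₀ (bsWeight_pos s τ _), bsWeight_expPt] at this

theorem norm_le_of_logFun {u : BSSpace s τ} {C : ℝ}
    (h : ∀ y, ‖logFun u y‖ ≤ C * logWeight s τ y) : ‖u‖ ≤ C := by
  have : Nonempty (Ioi (0 : ℝ)) := ⟨expPt 0⟩
  rw [norm_def]
  refine ciSup_le fun x => ?_
  have h1 := h (Real.log x)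
  rw [← bsWeight_expPt, expPt_log, ← val_eq_logFun] at h1
  rwa [div_le_iff₀ (bsWeight_pos s τ x)]

/-- The two conditions at `0` and at `∞` together say that the quotient by the weight vanishes at
infinity on the real line. -/
theorem tendsto_logFun_div_logWeight (u : BSSpace s τ) :
    Tendsto (fun y => logFun u y / (logWeight s τ y : ℂ)) (cocompact ℝ) (𝓝 0) := by
  obtain ⟨h1, h2⟩ := u.2
  have e1 : Tendsto expPt atTop (comap (fun x : Ioi (0 : ℝ) => (x : ℝ)) atTop) :=
    tendsto_comap_iff.2 Real.tendsto_exp_atTop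
  have e2 : Tendsto expPt atBot (comap (fun x : Ioi (0 : ℝ) => (x : ℝ)) (𝓝 0)) :=
    tendsto_comap_iff.2 Real.tendsto_exp_atBot
  have k1 := (h1.comp e1).norm
  have k2 := (h2.comp e2).norm
  rw [norm_zero] at k1 k2
  rw [cocompact_eq_atBot_atTop, tendsto_sup]
  constructor
  · refine squeeze_zero_norm (fun y => ?_) k2
    have hw : logWeight s τ y = (1 + Real.exp (s * y)) * (1 + (Real.exp y) ^ (-τ)) := by
      rw [logWeight, ← Real.exp_mul, mul_comm y]
    simp only [Function.comp_apply, norm_div, Complex.norm_real, expPt, logFun, hw, norm_mul]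
    refine div_le_div_of_nonneg_left (norm_nonneg _) ?_ ?_
    · rw [Real.norm_of_nonneg (by positivity)]; positivity
    · refine le_mul_of_one_le_left (norm_nonneg _) ?_
      rw [Real.norm_of_nonneg (by positivity)]
      linarith [Real.exp_pos (s * y)]
  · refine squeeze_zero_norm (fun y => ?_) k1
    have hw : logWeight s τ y = (1 + (Real.exp y) ^ s) * (1 + Real.exp (-τ * y)) := by
      rw [logWeight, ← Real.exp_mul, mul_comm y]
    simp only [Function.comp_apply, norm_div, Complex.norm_real, expPt, logFun, hw, norm_mul]
    refine div_le_div_of_nonneg_left (norm_nonneg _) ?_ ?_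
    · rw [Real.norm_of_nonneg (by positivity)]; positivity
    · refine le_mul_of_one_le_right (norm_nonneg _) ?_
      rw [Real.norm_of_nonneg (by positivity)]
      linarith [Real.exp_pos (-τ * y)]

theorem mem_bsSubmodule_of_tendsto (hs : 0 ≤ s) (hτ : 0 ≤ τ) {h : ℝ → ℂ} (hc : Continuous h)
    (ht : Tendsto (fun y => h y / (logWeight s τ y : ℂ)) (cocompact ℝ) (𝓝 0)) :
    (⟨fun x : Ioi (0 : ℝ) => h (Real.log x), hc.comp (Continuous.log continuous_subtype_val
      fun x => ne_of_gt x.2)⟩ : C(Ioi (0 : ℝ), ℂ)) ∈ bsSubmodule s τ := by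
  rw [cocompact_eq_atBot_atTop, tendsto_sup] at ht
  obtain ⟨hb, ht⟩ := ht
  have e1 : Tendsto (fun x : Ioi (0 : ℝ) => Real.log x)
      (comap (fun x : Ioi (0 : ℝ) => (x : ℝ)) atTop) atTop :=
    Real.tendsto_log_atTop.comp tendsto_comap
  have e2 : Tendsto (fun x : Ioi (0 : ℝ) => Real.log x)
      (comap (fun x : Ioi (0 : ℝ) => (x : ℝ)) (𝓝 0)) atBot := by
    refine Real.tendsto_log_nhdsGT_zero.comp (tendsto_nhdsWithin_iff.2 ⟨tendsto_comap, ?_⟩)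
    exact .of_forall fun x => x.2
  have w : ∀ x : Ioi (0 : ℝ), logWeight s τ (Real.log x) =
      (1 + (x : ℝ) ^ s) * (1 + (x : ℝ) ^ (-τ)) := by
    intro x
    rw [← bsWeight_expPt, expPt_log, bsWeight]
  have key : ∀ {c A B : ℝ}, 0 ≤ c → 0 < A → 0 < B → B ≤ 2 → c / A ≤ 2 * (c / (A * B)) := by
    intro c A B hc hA hB hB2
    rw [← mul_div_assoc, div_le_div_iff₀ hA (by positivity)]
    have : c * (A * B) ≤ c * (A * 2) := by gcongr
    linarith
  constructor
  · have k1 := ((ht.comp e1).norm).const_mul 2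
    rw [norm_zero, mul_zero] at k1
    refine squeeze_zero_norm' ?_ k1
    have : ∀ᶠ x : Ioi (0 : ℝ) in comap (fun x : Ioi (0 : ℝ) => (x : ℝ)) atTop, 1 ≤ (x : ℝ) :=
      tendsto_comap.eventually (eventually_ge_atTop 1)
    filter_upwards [this] with x hx
    have hx0 : (0 : ℝ) < x := x.2
    simp only [Function.comp_apply, norm_div, Complex.norm_real, w, ContinuousMap.coe_mk]
    rw [Real.norm_of_nonneg (by positivity), Real.norm_of_nonneg (by positivity)]
    refine key (norm_nonneg _) (by positivity) (by positivity) ?_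
    linarith [Real.rpow_le_one_of_one_le_of_nonpos hx (neg_nonpos.2 hτ)]
  · have k1 := ((hb.comp e2).norm).const_mul 2
    rw [norm_zero, mul_zero] at k1
    refine squeeze_zero_norm' ?_ k1
    have : ∀ᶠ x : Ioi (0 : ℝ) in comap (fun x : Ioi (0 : ℝ) => (x : ℝ)) (𝓝 0), (x : ℝ) ≤ 1 :=
      tendsto_comap.eventually (eventually_le_nhds one_pos)
    filter_upwards [this] with x hx
    have hx0 : (0 : ℝ) < x := x.2
    simp only [Function.comp_apply, norm_div, Complex.norm_real, w, ContinuousMap.coe_mk]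
    rw [Real.norm_of_nonneg (by positivity), Real.norm_of_nonneg (by positivity),
      mul_comm (1 + (x : ℝ) ^ s)]
    refine key (norm_nonneg _) (by positivity) (by positivity) ?_
    linarith [Real.rpow_le_one hx0.le hx hs]

theorem exists_logFun_eq (hs : 0 ≤ s) (hτ : 0 ≤ τ) {h : ℝ → ℂ} (hc : Continuous h)
    (ht : Tendsto (fun y => h y / (logWeight s τ y : ℂ)) (cocompact ℝ) (𝓝 0)) :
    ∃ u : BSSpace s τ, logFun u = h :=
  ⟨⟨_, mem_bsSubmodule_of_tendsto hs hτ hc ht⟩, funext fun y => by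
    change h (Real.log (Real.exp y)) = h y
    rw [Real.log_exp]⟩

/-- `Y^{s,τ}` is isometric to `C₀(ℝ)` by division by the weight. -/
theorem completeSpace (hs : 0 < s) (hτ : 0 ≤ τ) : CompleteSpace (BSSpace s τ) := by
  have hw : ∀ y, (logWeight s τ y : ℂ) ≠ 0 := fun y =>
    Complex.ofReal_ne_zero.2 (logWeight_pos s τ y).ne'
  let Ψ : BSSpace s τ → ZeroAtInftyContinuousMap ℝ ℂ := fun u =>
    { toFun := fun y => logFun u y / (logWeight s τ y : ℂ)
      continuous_toFun := (continuous_logFun u).div (by fun_prop) hw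
      zero_at_infty' := tendsto_logFun_div_logWeight u }
  have hΨn : ∀ u, ‖Ψ u‖ = ‖u‖ := by
    intro u
    have hn : ∀ y, ‖Ψ u y‖ = ‖logFun u y‖ / logWeight s τ y := fun y => by
      change ‖logFun u y / (logWeight s τ y : ℂ)‖ = _
      rw [norm_div, Complex.norm_real, Real.norm_of_nonneg (logWeight_pos s τ y).le]
    refine le_antisymm ?_ (norm_le_of_logFun fun y => ?_)
    · rw [← ZeroAtInftyContinuousMap.norm_toBCF_eq_norm,
        BoundedContinuousFunction.norm_le (norm_nonneg _)]
      intro y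
      change ‖Ψ u y‖ ≤ _
      rw [hn, div_le_iff₀ (logWeight_pos s τ y)]
      exact norm_logFun_le u y
    · rw [← div_le_iff₀ (logWeight_pos s τ y), ← hn, ← ZeroAtInftyContinuousMap.norm_toBCF_eq_norm]
      exact (Ψ u).toBCF.norm_coe_le_norm y
  have hΨ : Isometry Ψ := by
    refine Isometry.of_dist_eq fun u v => ?_
    rw [dist_eq_norm, dist_eq_norm, ← hΨn]
    congr 1
    ext y
    change logFun u y / (logWeight s τ y : ℂ) - logFun v y / (logWeight s τ y : ℂ) =
      logFun (u - v) y / (logWeight s τ y : ℂ)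
    rw [logFun_sub, sub_div]
  have hsurj : Function.Surjective Ψ := by
    intro f
    obtain ⟨u, hu⟩ := exists_logFun_eq hs.le hτ (h := fun y => logWeight s τ y * f y) (by fun_prop) (by
      refine f.zero_at_infty'.congr fun y => ?_
      rw [mul_div_cancel_left₀ _ (hw y)]
      rfl)
    refine ⟨u, ?_⟩
    ext y
    change logFun u y / (logWeight s τ y : ℂ) = f y
    rw [hu]
    exact mul_div_cancel_left₀ _ (hw y)
  exact (hΨ.isUniformInducing.completeSpace_congr hsurj).2 inferInstance

/-! ### The exponentials `y ↦ exp (κ y)` -/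

theorem exp_mul_le_logWeight {α y : ℝ} (h0 : 0 ≤ α) (hα : α ≤ s) :
    Real.exp (α * y) ≤ logWeight s τ y := by
  have h1 : Real.exp (α * y) ≤ 1 + Real.exp (s * y) := by
    rcases le_total 0 y with hy | hy
    · have : Real.exp (α * y) ≤ Real.exp (s * y) := Real.exp_le_exp.2 (by gcongr)
      linarith
    · have : Real.exp (α * y) ≤ 1 := Real.exp_le_one_iff.2 (mul_nonpos_of_nonneg_of_nonpos h0 hy)
      linarith [Real.exp_pos (s * y)]
  refine h1.trans (le_mul_of_one_le_right (by positivity) ?_)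
  linarith [Real.exp_pos (-τ * y)]

theorem tendsto_exp_mul_div_logWeight {α : ℝ} (h0 : 0 < α) (hα : α < s) :
    Tendsto (fun y => Real.exp (α * y) / logWeight s τ y) (cocompact ℝ) (𝓝 0) := by
  rw [cocompact_eq_atBot_atTop, tendsto_sup]
  constructor
  · have : Tendsto (fun y : ℝ => Real.exp (α * y)) atBot (𝓝 0) :=
      Real.tendsto_exp_atBot.comp (tendsto_id.const_mul_atBot h0)
    refine squeeze_zero (fun y => (div_pos (Real.exp_pos _) (logWeight_pos s τ y)).le)
      (fun y => ?_) this
    refine div_le_self (Real.exp_pos _).le ?_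
    unfold logWeight
    nlinarith [Real.exp_pos (s * y), Real.exp_pos (-τ * y),
      mul_pos (Real.exp_pos (s * y)) (Real.exp_pos (-τ * y))]
  · have : Tendsto (fun y : ℝ => Real.exp ((α - s) * y)) atTop (𝓝 0) :=
      Real.tendsto_exp_atBot.comp (tendsto_id.const_mul_atTop_of_neg (sub_neg.2 hα))
    refine squeeze_zero (fun y => (div_pos (Real.exp_pos _) (logWeight_pos s τ y)).le)
      (fun y => ?_) this
    rw [div_le_iff₀ (logWeight_pos s τ y), sub_mul, Real.exp_sub, div_mul_eq_mul_div,
      le_div_iff₀ (Real.exp_pos _)]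
    refine mul_le_mul_of_nonneg_left ?_ (Real.exp_pos _).le
    unfold logWeight
    nlinarith [Real.exp_pos (s * y), Real.exp_pos (-τ * y),
      mul_pos (Real.exp_pos (s * y)) (Real.exp_pos (-τ * y))]

/-- A continuous function dominated by `C (exp (α y) + exp (β y))` with `α, β` in `(0, s)` is an
element of `Y^{s,τ}`. -/
theorem exists_logFun_eq_of_le (hτ : 0 ≤ τ) {h : ℝ → ℂ} (hc : Continuous h) {C α β : ℝ} (hα : 0 < α)
    (hαs : α < s) (hβ : 0 < β) (hβs : β < s)
    (hb : ∀ y, ‖h y‖ ≤ C * (Real.exp (α * y) + Real.exp (β * y))) :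
    ∃ u : BSSpace s τ, logFun u = h := by
  refine exists_logFun_eq (hα.trans hαs).le hτ hc ?_
  have h1 := ((tendsto_exp_mul_div_logWeight (τ := τ) hα hαs).add
    (tendsto_exp_mul_div_logWeight (τ := τ) hβ hβs)).const_mul C
  rw [add_zero, mul_zero] at h1
  refine squeeze_zero_norm (fun y => ?_) h1
  rw [norm_div, Complex.norm_real, Real.norm_of_nonneg (logWeight_pos s τ y).le, ← add_div,
    ← mul_div_assoc]
  exact div_le_div_of_nonneg_right (hb y) (logWeight_pos s τ y).le

theorem norm_cexp_mul_ofReal (κ : ℂ) (y : ℝ) : ‖Complex.exp (κ * y)‖ = Real.exp (κ.re * y) := by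
  rw [Complex.norm_exp]; simp

theorem exists_logFun_eq_exp (hτ : 0 ≤ τ) {κ : ℂ} (h0 : 0 < κ.re) (h1 : κ.re < s) :
    ∃ u : BSSpace s τ, logFun u = fun y : ℝ => Complex.exp (κ * y) := by
  refine exists_logFun_eq_of_le hτ (by fun_prop) (C := 1) h0 h1 h0 h1 fun y => ?_
  rw [norm_cexp_mul_ofReal]
  linarith [Real.exp_pos (κ.re * y)]

open Classical in
/-- The power `x ↦ x ^ κ`, that is `y ↦ exp (κ y)` in the logarithmic variable, as an element of
`Y^{s,τ}`; it is set to zero if `κ` lies outside the strip `0 < Re κ < s`. -/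
noncomputable def power (s τ : ℝ) (κ : ℂ) : BSSpace s τ :=
  if h : 0 ≤ τ ∧ 0 < κ.re ∧ κ.re < s then (exists_logFun_eq_exp h.1 h.2.1 h.2.2).choose else 0

theorem logFun_power (hτ : 0 ≤ τ) {κ : ℂ} (h0 : 0 < κ.re) (h1 : κ.re < s) (y : ℝ) :
    logFun (power s τ κ) y = Complex.exp (κ * y) := by
  have h : 0 ≤ τ ∧ 0 < κ.re ∧ κ.re < s := ⟨hτ, h0, h1⟩
  rw [power, dif_pos h]
  exact congrFun (exists_logFun_eq_exp h.1 h.2.1 h.2.2).choose_spec y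

/-- The strip of the exponents `κ` for which `x ^ κ` belongs to `Y^{s,τ}`. -/
def powerStrip (s : ℝ) : Set ℂ := {κ | 0 < κ.re ∧ κ.re < s}

/-- `κ ↦ x ^ κ` is holomorphic with respect to the norm of `Y^{s,τ}`. -/
theorem differentiableOn_power (hτ : 0 ≤ τ) :
    DifferentiableOn ℂ (power s τ) (powerStrip s) := by
  rintro κ ⟨h0, h1⟩
  -- the Taylor remainder is dominated by exponentials whose exponents stay in the strip
  set δ : ℝ := min κ.re (s - κ.re) / 4 with hδ
  have hm : 0 < min κ.re (s - κ.re) := lt_min h0 (sub_pos.2 h1)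
  have hδ0 : 0 < δ := by positivity
  have hδ1 : 4 * δ ≤ κ.re := by rw [hδ]; linarith [min_le_left κ.re (s - κ.re)]
  have hδ2 : κ.re + 4 * δ ≤ s := by rw [hδ]; linarith [min_le_right κ.re (s - κ.re)]
  have hcosh : ∀ {ε : ℝ}, 0 ≤ ε → ∀ y : ℝ, Real.exp (κ.re * y) * Real.exp (ε * |y|) ≤
      Real.exp ((κ.re + ε) * y) + Real.exp ((κ.re - ε) * y) := by
    intro ε hε y
    rw [← Real.exp_add]
    rcases abs_cases y with ⟨h, _⟩ | ⟨h, _⟩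
    · have : κ.re * y + ε * |y| = (κ.re + ε) * y := by rw [h]; ring
      rw [this]; linarith [Real.exp_pos ((κ.re - ε) * y)]
    · have : κ.re * y + ε * |y| = (κ.re - ε) * y := by rw [h]; ring
      rw [this]; linarith [Real.exp_pos ((κ.re + ε) * y)]
  obtain ⟨D, hD⟩ : ∃ u : BSSpace s τ, logFun u = fun y : ℝ => y * Complex.exp (κ * y) := by
    refine exists_logFun_eq_of_le hτ (by fun_prop) (C := 1 / δ) (α := κ.re + δ) (β := κ.re - δ)
      (by linarith) (by linarith) (by linarith) (by linarith) fun y => ?_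
    rw [norm_mul, norm_cexp_mul_ofReal, Complex.norm_real, Real.norm_eq_abs]
    have h2 : |y| ≤ 1 / δ * Real.exp (δ * |y|) := by
      rw [one_div, inv_mul_eq_div, le_div_iff₀ hδ0]
      linarith [Real.add_one_le_exp (δ * |y|)]
    calc |y| * Real.exp (κ.re * y) ≤ 1 / δ * Real.exp (δ * |y|) * Real.exp (κ.re * y) := by gcongr
      _ = 1 / δ * (Real.exp (κ.re * y) * Real.exp (δ * |y|)) := by ring
      _ ≤ _ := by gcongr; exact hcosh hδ0.le y
  have hderiv : HasDerivAt (power s τ) D κ := by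
    rw [hasDerivAt_iff_isLittleO_nhds_zero]
    have hO : (fun h : ℂ => power s τ (κ + h) - power s τ κ - h • D) =O[𝓝 0]
        fun h => ‖h‖ ^ 2 := by
      refine Asymptotics.IsBigO.of_bound (4 / δ ^ 2) ?_
      filter_upwards [Metric.ball_mem_nhds (0 : ℂ) hδ0] with h hh
      rw [mem_ball_zero_iff] at hh
      have hre : |h.re| < δ := (Complex.abs_re_le_norm h).trans_lt hh
      rw [abs_lt] at hre
      refine norm_le_of_logFun fun y => ?_
      have hk0 : 0 < (κ + h).re := by rw [Complex.add_re]; linarith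
      have hk1 : (κ + h).re < s := by rw [Complex.add_re]; linarith
      rw [logFun_sub, logFun_sub, logFun_smul, logFun_power hτ hk0 hk1, logFun_power hτ h0 h1, hD]
      have e1 : Complex.exp ((κ + h) * y) - Complex.exp (κ * y) - h * (y * Complex.exp (κ * y)) =
          Complex.exp (κ * y) * (Complex.exp (h * y) - ∑ m ∈ Finset.range 2,
            (h * y) ^ m / (m.factorial : ℂ)) := by
        rw [add_mul, Complex.exp_add]
        simp [Finset.sum_range_succ]
        ring
      have e2 := Complex.norm_exp_sub_sum_le_norm_mul_exp (h * y) 2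
      have e3 : ‖h * y‖ ≤ δ * |y| := by
        rw [norm_mul, Complex.norm_real, Real.norm_eq_abs]; gcongr
      have e4 : y ^ 2 ≤ 2 / δ ^ 2 * Real.exp (δ * |y|) := by
        have := Real.quadratic_le_exp_of_nonneg (x := δ * |y|) (by positivity)
        rw [mul_pow, sq_abs] at this
        rw [div_mul_eq_mul_div, le_div_iff₀ (by positivity)]
        nlinarith [mul_nonneg hδ0.le (abs_nonneg y)]
      rw [e1, norm_mul, norm_cexp_mul_ofReal, norm_pow, norm_norm]
      calc Real.exp (κ.re * y) * _ ≤ Real.exp (κ.re * y) * (‖h * y‖ ^ 2 * Real.exp ‖h * y‖) := by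
            gcongr
        _ ≤ Real.exp (κ.re * y) * (‖h‖ ^ 2 * (2 / δ ^ 2 * Real.exp (δ * |y|)) *
              Real.exp (δ * |y|)) := by
            rw [norm_mul h, mul_pow, Complex.norm_real, Real.norm_eq_abs, sq_abs]
            rw [norm_mul, Complex.norm_real, Real.norm_eq_abs] at e3
            gcongr
        _ = 2 / δ ^ 2 * ‖h‖ ^ 2 * (Real.exp (κ.re * y) * Real.exp (2 * δ * |y|)) := by
            rw [show 2 * δ * |y| = δ * |y| + δ * |y| by ring, Real.exp_add]; ring
        _ ≤ 2 / δ ^ 2 * ‖h‖ ^ 2 * (logWeight s τ y + logWeight s τ y) := by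
            gcongr
            refine (hcosh (by positivity) y).trans (add_le_add ?_ ?_)
            · exact exp_mul_le_logWeight (by linarith) (by linarith)
            · exact exp_mul_le_logWeight (by linarith) (by linarith)
        _ = 4 / δ ^ 2 * ‖h‖ ^ 2 * logWeight s τ y := by ring
    refine hO.trans_isLittleO ?_
    have : (fun h : ℂ => ‖h‖ ^ 2) =o[𝓝 0] fun h : ℂ => ‖h‖ := by
      exact (Asymptotics.isLittleO_pow_id (𝕜 := ℝ) one_lt_two).comp_tendsto
        (tendsto_norm_zero (E := ℂ))
    exact this.of_norm_right
  exact hderiv.differentiableAt.differentiableWithinAt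

/-! ### The powers span a dense subspace -/

/-- Functions with compact support are dense in `Y^{s,τ}`. -/
theorem exists_support_subset_Icc_norm_sub_le (hs : 0 < s) (hτ : 0 ≤ τ) (u : BSSpace s τ) {ε : ℝ}
    (hε : 0 < ε) : ∃ (R : ℝ) (v : BSSpace s τ), 0 < R ∧ (∀ y, R ≤ |y| → logFun v y = 0) ∧
      ‖u - v‖ ≤ ε := by
  have h1 := (tendsto_logFun_div_logWeight u).norm
  rw [norm_zero] at h1
  have h2 := h1.eventually (gt_mem_nhds hε)
  rw [cocompact_eq_atBot_atTop, ← comap_abs_atTop, eventually_comap] at h2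
  obtain ⟨R₀, hR₀⟩ := eventually_atTop.1 h2
  set R := max R₀ 1
  let χ : ℝ → ℝ := fun y => max 0 (min 1 (R + 1 - |y|))
  have hχ0 : ∀ y, 0 ≤ χ y := fun y => le_max_left _ _
  have hχ1 : ∀ y, χ y ≤ 1 := fun y => max_le zero_le_one (min_le_left _ _)
  have hχc : Continuous χ := by fun_prop
  obtain ⟨v, hv⟩ := exists_logFun_eq hs.le hτ (h := fun y => χ y * logFun u y) (by fun_prop) (by
    refine squeeze_zero_norm (fun y => ?_) h1
    rw [mul_div_assoc, norm_mul, Complex.norm_real, Real.norm_of_nonneg (hχ0 y)]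
    exact mul_le_of_le_one_left (norm_nonneg _) (hχ1 y))
  refine ⟨R + 1, v, by positivity, fun y hy => ?_, norm_le_of_logFun fun y => ?_⟩
  · have : χ y = 0 := max_eq_left ((min_le_right _ _).trans (by linarith))
    rw [hv]
    simp [this]
  · have e : logFun (u - v) y = ((1 - χ y : ℝ) : ℂ) * logFun u y := by
      rw [logFun_sub, hv]; push_cast; ring
    rw [e, norm_mul, Complex.norm_real, Real.norm_of_nonneg (sub_nonneg.2 (hχ1 y))]
    rcases le_total R |y| with hy | hy
    · have h3 := hR₀ _ ((le_max_left _ _).trans hy) y rfl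
      rw [norm_div, Complex.norm_real, Real.norm_of_nonneg (logWeight_pos s τ y).le,
        div_lt_iff₀ (logWeight_pos s τ y)] at h3
      exact (mul_le_of_le_one_left (norm_nonneg _) (by linarith [hχ0 y])).trans h3.le
    · have : χ y = 1 := by
        simp only [χ]
        rw [min_eq_left (by linarith), max_eq_right zero_le_one]
      rw [this, sub_self, zero_mul]
      exact mul_nonneg hε.le (logWeight_pos s τ y).le

/-- Multiplying a trigonometric polynomial by `exp (c y)` gives a linear combination of powers. -/
theorem exists_mem_span_power_logFun_eq (hτ : 0 ≤ τ) {c A : ℝ} (h0 : 0 < c) (h1 : c < s)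
    {p : C(AddCircle A, ℂ)} (hp : p ∈ Submodule.span ℂ (range (@fourier A))) :
    ∃ q ∈ Submodule.span ℂ (power s τ '' powerStrip s),
      ∀ y : ℝ, logFun q y = Complex.exp (c * y) * p (y : AddCircle A) := by
  induction hp using Submodule.span_induction with
  | mem p hp =>
    obtain ⟨n, rfl⟩ := hp
    set κ : ℂ := c + 2 * Real.pi * Complex.I * n / A with hκ
    have hre : κ.re = c := by
      have : 2 * Real.pi * Complex.I * n / A = ((2 * Real.pi * n / A : ℝ) : ℂ) * Complex.I := by
        push_cast; ring
      rw [hκ, this]; simp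
    refine ⟨power s τ κ, Submodule.subset_span ⟨κ, ⟨by rwa [hre], by rwa [hre]⟩, rfl⟩, fun y => ?_⟩
    rw [logFun_power hτ (by rwa [hre]) (by rwa [hre]), fourier_coe_apply, ← Complex.exp_add, hκ]
    congr 1
    ring
  | zero => exact ⟨0, zero_mem _, fun y => by simp⟩
  | add p p' _ _ hp hp' =>
    obtain ⟨q, hq, e⟩ := hp
    obtain ⟨q', hq', e'⟩ := hp'
    refine ⟨q + q', add_mem hq hq', fun y => ?_⟩
    rw [logFun_add, e, e', ContinuousMap.add_apply, mul_add]
  | smul a p _ hp =>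
    obtain ⟨q, hq, e⟩ := hp
    refine ⟨a • q, Submodule.smul_mem _ a hq, fun y => ?_⟩
    rw [logFun_smul, e, ContinuousMap.smul_apply, smul_eq_mul]
    ring

theorem exp_half_mul_le (hs : 0 ≤ s) {y A : ℝ} (hy : A ≤ |y|) :
    Real.exp (s / 2 * y) ≤ Real.exp (-(s / 2 * A)) * logWeight s τ y := by
  have hw : 1 ≤ logWeight s τ y ∧ Real.exp (s * y) ≤ logWeight s τ y := by
    unfold logWeight
    constructor <;> nlinarith [Real.exp_pos (s * y), Real.exp_pos (-τ * y),
      mul_pos (Real.exp_pos (s * y)) (Real.exp_pos (-τ * y))]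
  rcases abs_cases y with ⟨h, _⟩ | ⟨h, _⟩
  · calc Real.exp (s / 2 * y) = Real.exp (-(s / 2 * y)) * Real.exp (s * y) := by
          rw [← Real.exp_add]; congr 1; ring
      _ ≤ Real.exp (-(s / 2 * A)) * Real.exp (s * y) := by
          gcongr; rwa [h] at hy
      _ ≤ _ := by gcongr; exact hw.2
  · calc Real.exp (s / 2 * y) ≤ Real.exp (-(s / 2 * A)) * 1 := by
          rw [mul_one]
          refine Real.exp_le_exp.2 ?_
          have : A ≤ -y := by rwa [h] at hy
          nlinarith
      _ ≤ _ := by gcongr; exact hw.1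

/-- The powers `x ^ κ` with `0 < Re κ < s` span a dense subspace: after division by `x ^ (s / 2)`, a
function of compact support in `log x` is extended periodically with a large period and approximated
by trigonometric polynomials; outside of one period the weight makes the error small. -/
theorem dense_span_power (hs : 0 < s) (hτ : 0 ≤ τ) :
    Dense (Submodule.span ℂ (power s τ '' powerStrip s) : Set (BSSpace s τ)) := by
  intro u
  rw [Metric.mem_closure_iff]
  intro ε hε
  obtain ⟨R, v, hR, hv0, huv⟩ := exists_support_subset_Icc_norm_sub_le hs hτ u (half_pos hε)
  set f : ℝ → ℂ := fun y => Complex.exp (-(s / 2 : ℝ) * y) * logFun v y with hf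
  have hfc : Continuous f := by fun_prop
  have hf0 : ∀ y, R ≤ |y| → f y = 0 := fun y hy => by simp [hf, hv0 y hy]
  obtain ⟨K, hK⟩ : ∃ K, ∀ y, ‖f y‖ ≤ K := by
    obtain ⟨K, hK⟩ := (isCompact_Icc (a := -R) (b := R)).exists_bound_of_continuousOn
      hfc.continuousOn
    refine ⟨max K 0, fun y => ?_⟩
    rcases le_total R |y| with hy | hy
    · rw [hf0 y hy, norm_zero]; exact le_max_right _ _
    · exact (hK y (abs_le.1 hy)).trans (le_max_left _ _)
  have hK0 : 0 ≤ K := (norm_nonneg _).trans (hK 0)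
  -- the half period `A` is chosen so that the error outside `[-A, A]` is at most `ε / 4`
  obtain ⟨A, hAR, hA⟩ : ∃ A, R ≤ A ∧ (K + 1) * Real.exp (-(s / 2 * A)) ≤ ε / 4 := by
    have h1 : Tendsto (fun A : ℝ => (K + 1) * Real.exp (-(s / 2 * A))) atTop (𝓝 0) := by
      have : Tendsto (fun A : ℝ => Real.exp (-(s / 2 * A))) atTop (𝓝 0) :=
        Real.tendsto_exp_neg_atTop_nhds_zero.comp (tendsto_id.const_mul_atTop (by positivity))
      simpa using this.const_mul (K + 1)
    exact ((eventually_ge_atTop R).and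
      ((h1.eventually (ge_mem_nhds (by positivity : 0 < ε / 4))))).exists
  have hA0 : 0 < A := hR.trans_le hAR
  have : Fact (0 < 2 * A) := ⟨by positivity⟩
  have hend : -A + 2 * A = A := by ring
  let g : C(AddCircle (2 * A), ℂ) := ⟨AddCircle.liftIco (2 * A) (-A) f,
    AddCircle.liftIco_continuous (by
      rw [hend, hf0 A (by rwa [abs_of_pos hA0]), hf0 (-A) (by rwa [abs_neg, abs_of_pos hA0])])
      hfc.continuousOn⟩
  have hg : ∀ y ∈ Ico (-A) A, g y = f y := fun y hy =>
    AddCircle.liftIco_coe_apply (f := f) (a := -A) (by rwa [hend])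
  have hgK : ‖g‖ ≤ K := by
    rw [ContinuousMap.norm_le _ hK0]
    intro x
    rw [← AddCircle.coe_equivIco (p := 2 * A) (a := -A) (y := x)]
    have hy := (AddCircle.equivIco (2 * A) (-A) x).2
    rw [hg _ ⟨hy.1, hy.2.trans_eq hend⟩]
    exact hK _
  set η : ℝ := min (ε / 4) 1 with hη
  have hη0 : 0 < η := by positivity
  obtain ⟨p, hp, hpg⟩ : ∃ p ∈ Submodule.span ℂ (range (@fourier (2 * A))), ‖g - p‖ < η := by
    have hg' : g ∈ (Submodule.span ℂ (range (@fourier (2 * A)))).topologicalClosure := by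
      rw [span_fourier_closure_eq_top]; trivial
    obtain ⟨p, hp, h⟩ := Metric.mem_closure_iff.1 hg' η hη0
    exact ⟨p, hp, by rwa [dist_eq_norm] at h⟩
  obtain ⟨q, hq, hqp⟩ := exists_mem_span_power_logFun_eq (s := s) (τ := τ) (c := s / 2) hτ
    (by positivity) (by linarith) hp
  refine ⟨q, hq, ?_⟩
  have hvq : ‖v - q‖ ≤ ε / 4 := by
    refine norm_le_of_logFun fun y => ?_
    have e : logFun (v - q) y = Complex.exp ((s / 2 : ℝ) * y) * (f y - p y) := by
      rw [logFun_sub, hqp, mul_sub, hf]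
      simp only
      rw [← mul_assoc, ← Complex.exp_add]
      simp
    have hw0 := logWeight_pos s τ y
    rw [e, norm_mul, norm_cexp_mul_ofReal, Complex.ofReal_re]
    by_cases hy : y ∈ Ico (-A) A
    · have h1 : ‖f y - p y‖ ≤ ε / 4 := by
        rw [← hg y hy]
        exact ((g - p).norm_coe_le_norm y).trans (hpg.le.trans (min_le_left _ _))
      have h2 := exp_mul_le_logWeight (s := s) (τ := τ) (α := s / 2) (y := y) (by positivity)
        (by linarith)
      calc _ ≤ logWeight s τ y * (ε / 4) := by gcongr
        _ = _ := mul_comm _ _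
    · have hAy : A ≤ |y| := by
        by_contra h
        rw [not_le, abs_lt] at h
        exact hy ⟨h.1.le, h.2⟩
      have h1 : ‖f y - p y‖ ≤ K + 1 := by
        rw [hf0 y (hAR.trans hAy), zero_sub, norm_neg]
        have h2 := p.norm_coe_le_norm (y : AddCircle (2 * A))
        have h3 : ‖p‖ ≤ ‖g‖ + ‖g - p‖ := by
          rw [norm_sub_rev]; simpa using norm_add_le g (p - g)
        linarith [min_le_right (ε / 4) 1]
      calc _ ≤ Real.exp (-(s / 2 * A)) * logWeight s τ y * (K + 1) := by
            have := exp_half_mul_le (τ := τ) hs.le hAy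
            gcongr
        _ = (K + 1) * Real.exp (-(s / 2 * A)) * logWeight s τ y := by ring
        _ ≤ _ := by gcongr
  rw [dist_eq_norm]
  calc ‖u - q‖ = ‖(u - v) + (v - q)‖ := by congr 1; abel
    _ ≤ ε / 2 + ε / 4 := (norm_add_le _ _).trans (add_le_add huv hvq)
    _ < ε := by linarith

theorem separableSpace (hs : 0 < s) (hτ : 0 ≤ τ) : TopologicalSpace.SeparableSpace (BSSpace s τ) := by
  have h1 : TopologicalSpace.IsSeparable (power s τ '' powerStrip s) := by
    rw [image_eq_range]
    have : Continuous fun κ : powerStrip s => power s τ κ :=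
      (differentiableOn_power hτ).continuousOn.domRestrict
    exact TopologicalSpace.isSeparable_range this
  have h2 := (h1.span (R := ℂ)).closure
  rw [(dense_span_power hs hτ).closure_eq] at h2
  exact TopologicalSpace.isSeparable_univ_iff.1 h2

end BSSpace

/-! ### Resolvents and integrated orbits on a total set of eigenvectors -/

section IntegratedOrbit

variable {X : Type*} [NormedAddCommGroup X] [NormedSpace ℂ X] [CompleteSpace X]

/-- If a strongly continuous family `P s` and an operator `R` act on a total family of common
eigenvectors like `exp (s q)` and `(c - q)⁻¹`, then `R` inverts `c - A` for the generator `A` of `P`, in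
integrated form. -/
theorem sub_eq_integral_of_dense_span {P : ℝ → X →L[ℂ] X}
    (hP : Continuous fun p : ℝ × X => P p.1 p.2) {Ω : Set ℂ} {e : ℂ → X}
    (hd : Dense (Submodule.span ℂ (e '' Ω) : Set X)) {q : ℂ → ℂ} {t : ℝ}
    (heig : ∀ z ∈ Ω, ∀ a ∈ uIcc 0 t, P a (e z) = Complex.exp (a * q z) • e z)
    {R : X →L[ℂ] X} {c : ℂ} (hR : ∀ z ∈ Ω, R (e z) = (c - q z)⁻¹ • e z)
    (hc : ∀ z ∈ Ω, c - q z ≠ 0) (f : X) :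
    P t (R f) - R f = ∫ a in 0..t, P a (c • R f - f) := by
  have hcont : ∀ x, Continuous fun a => P a x := fun x =>
    hP.comp (continuous_id.prodMk continuous_const)
  have hint : ∀ x, IntervalIntegrable (fun a => P a x) volume 0 t := fun x =>
    (hcont x).intervalIntegrable _ _
  have hclosed : IsClosed {f : X | P t (R f) - R f = ∫ a in 0..t, P a (c • R f - f)} := by
    refine isClosed_eq (by fun_prop) ?_
    refine intervalIntegral.continuous_parametric_intervalIntegral_of_continuous'
      (f := fun f a => P a (c • R f - f)) ?_ 0 t
    have h1 : Continuous fun p : X × ℝ => (p.2, c • R p.1 - p.1) := by fun_prop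
    exact hP.comp h1
  refine closure_minimal (s := (Submodule.span ℂ (e '' Ω) : Set X)) ?_ hclosed (hd f)
  intro f hf
  simp only [mem_ofPred_eq]
  induction hf using Submodule.span_induction with
  | mem x hx =>
    obtain ⟨z, hz, rfl⟩ := hx
    have e1 : c • R (e z) - e z = (q z * (c - q z)⁻¹) • e z := by
      rw [hR z hz, smul_smul]
      nth_rewrite 2 [← one_smul ℂ (e z)]
      rw [← sub_smul]
      congr 1
      have := hc z hz
      field_simp
      ring
    have hder : ∀ a ∈ uIcc 0 t, HasDerivAt
        (fun a : ℝ => (Complex.exp (a * q z) * (c - q z)⁻¹) • e z) (P a (c • R (e z) - e z)) a := by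
      intro a ha
      have h1 : HasDerivAt (fun a : ℝ => Complex.exp (a * q z)) (Complex.exp (a * q z) * q z) a := by
        simpa using ((hasDerivAt_id (a : ℂ)).mul_const (q z)).cexp.comp_ofReal
      have h2 := (h1.mul_const (c - q z)⁻¹).smul_const (e z)
      rw [e1, map_smul, heig z hz a ha, smul_smul]
      convert h2 using 2
      ring
    rw [intervalIntegral.integral_eq_sub_of_hasDerivAt hder (hint _), hR z hz, map_smul,
      heig z hz t right_mem_uIcc, smul_smul]
    simp [mul_comm]
  | zero => simp
  | add x y _ _ hx hy =>
    have e2 : ∀ a, P a (c • R (x + y) - (x + y)) = P a (c • R x - x) + P a (c • R y - y) := by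
      intro a; rw [← map_add]; congr 1; simp only [map_add, smul_add]; abel
    simp only [e2]
    rw [intervalIntegral.integral_add (hint _) (hint _), ← hx, ← hy]
    simp only [map_add]
    abel
  | smul k x _ hx =>
    have e2 : ∀ a, P a (c • R (k • x) - k • x) = k • P a (c • R x - x) := by
      intro a
      rw [← map_smul (P a)]
      congr 1
      rw [map_smul, smul_sub, smul_comm]
    simp only [e2]
    rw [intervalIntegral.integral_smul, ← hx]
    simp only [map_smul, smul_sub]

end IntegratedOrbit

/-! ### Translations and their averages -/

namespace BSSpace

variable {s τ : ℝ}

theorem logWeight_add_le (hs : 0 ≤ s) (hτ : 0 ≤ τ) (y a : ℝ) :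
    logWeight s τ (y + a) ≤ Real.exp ((s + τ) * |a|) * logWeight s τ y := by
  have key : ∀ {c d : ℝ}, d ≤ c * |a| → 0 ≤ c → ∀ x, 1 + Real.exp (x + d) ≤
      Real.exp (c * |a|) * (1 + Real.exp x) := by
    intro c d hd hc x
    rw [mul_add, mul_one, ← Real.exp_add, add_comm _ x]
    exact add_le_add (Real.one_le_exp (by positivity)) (Real.exp_le_exp.2 (by linarith))
  have h1 := key (c := s) (d := s * a) (mul_le_mul_of_nonneg_left (le_abs_self a) hs) hs (s * y)
  have h2 := key (c := τ) (d := -τ * a) (by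
    rw [neg_mul_comm]; exact mul_le_mul_of_nonneg_left (neg_le_abs a) hτ) hτ (-τ * y)
  unfold logWeight
  rw [mul_add s, mul_add (-τ), add_mul s τ, Real.exp_add (s * |a|)]
  calc _ ≤ Real.exp (s * |a|) * (1 + Real.exp (s * y)) *
        (Real.exp (τ * |a|) * (1 + Real.exp (-τ * y))) := by gcongr
    _ = _ := by ring

theorem exists_logFun_eq_shift (hs : 0 ≤ s) (hτ : 0 ≤ τ) (a : ℝ) (u : BSSpace s τ) :
    ∃ v : BSSpace s τ, logFun v = fun y => logFun u (y + a) := by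
  refine exists_logFun_eq hs hτ (by fun_prop) ?_
  have h1 := ((tendsto_logFun_div_logWeight u).comp
    (Homeomorph.addRight a).isClosedEmbedding.tendsto_cocompact).norm.const_mul
      (Real.exp ((s + τ) * |a|))
  rw [norm_zero, mul_zero] at h1
  refine squeeze_zero_norm (fun y => ?_) h1
  have hw := logWeight_pos s τ y
  have hw' := logWeight_pos s τ (y + a)
  simp only [Function.comp_apply, Homeomorph.coe_addRight, norm_div, Complex.norm_real,
    Real.norm_of_nonneg hw.le, Real.norm_of_nonneg hw'.le]
  rw [← mul_div_assoc, div_le_div_iff₀ hw hw']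
  nlinarith [logWeight_add_le hs hτ y a, norm_nonneg (logFun u (y + a))]

/-- The translated function, as an element of `Y^{s,τ}`. -/
noncomputable def shiftFun (hs : 0 ≤ s) (hτ : 0 ≤ τ) (a : ℝ) (u : BSSpace s τ) : BSSpace s τ :=
  (exists_logFun_eq_shift hs hτ a u).choose

theorem logFun_shiftFun (hs : 0 ≤ s) (hτ : 0 ≤ τ) (a : ℝ) (u : BSSpace s τ) (y : ℝ) :
    logFun (shiftFun hs hτ a u) y = logFun u (y + a) :=
  congrFun (exists_logFun_eq_shift hs hτ a u).choose_spec y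

/-- The translation `u (x) ↦ u (exp a x)`, that is `y ↦ y + a` in the logarithmic variable. -/
noncomputable def shift (hs : 0 ≤ s) (hτ : 0 ≤ τ) (a : ℝ) : BSSpace s τ →L[ℂ] BSSpace s τ :=
  LinearMap.mkContinuous
    { toFun := shiftFun hs hτ a
      map_add' := fun u v => logFun_injective (by
        ext y
        simp only [logFun_add, logFun_shiftFun])
      map_smul' := fun c u => logFun_injective (by
        ext y
        simp only [RingHom.id_apply, logFun_smul, logFun_shiftFun]) }
    (Real.exp ((s + τ) * |a|)) (fun u => norm_le_of_logFun fun y => by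
      simp only [LinearMap.coe_mk, AddHom.coe_mk, logFun_shiftFun]
      refine (norm_logFun_le u (y + a)).trans ?_
      have := mul_le_mul_of_nonneg_left (logWeight_add_le hs hτ y a) (norm_nonneg u)
      linarith)

theorem logFun_shift (hs : 0 ≤ s) (hτ : 0 ≤ τ) (a : ℝ) (u : BSSpace s τ) (y : ℝ) :
    logFun (shift hs hτ a u) y = logFun u (y + a) :=
  logFun_shiftFun hs hτ a u y

theorem norm_shift_le (hs : 0 ≤ s) (hτ : 0 ≤ τ) (a : ℝ) :
    ‖shift hs hτ a‖ ≤ Real.exp ((s + τ) * |a|) :=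
  LinearMap.mkContinuous_norm_le _ (Real.exp_pos _).le _

theorem shift_power (hs : 0 ≤ s) (hτ : 0 ≤ τ) (a : ℝ) {κ : ℂ} (hκ : κ ∈ powerStrip s) :
    shift hs hτ a (power s τ κ) = Complex.exp (a * κ) • power s τ κ := by
  refine logFun_injective (funext fun y => ?_)
  rw [logFun_shift, logFun_smul, logFun_power hτ hκ.1 hκ.2, logFun_power hτ hκ.1 hκ.2,
    ← Complex.exp_add]
  congr 1
  push_cast
  ring

theorem eventually_norm_shift_le (hs : 0 ≤ s) (hτ : 0 ≤ τ) (a₀ : ℝ) :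
    ∀ᶠ a in 𝓝 a₀, ‖shift hs hτ a‖ ≤ Real.exp ((s + τ) * |a₀|) + 1 := by
  have h : Continuous fun a : ℝ => Real.exp ((s + τ) * |a|) := by fun_prop
  filter_upwards [(h.tendsto a₀).eventually (ge_mem_nhds (lt_add_one _))] with a ha
  exact (norm_shift_le hs hτ a).trans ha

/-- The translations are strongly continuous, because they are so on the powers. -/
theorem continuous_shift_apply (hs : 0 < s) (hτ : 0 ≤ τ) (u : BSSpace s τ) :
    Continuous fun a => shift hs.le hτ a u := by
  rw [continuous_iff_continuousAt]
  intro a₀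
  refine tendsto_clm_apply_of_dense_span (eventually_norm_shift_le hs.le hτ a₀)
    (dense_span_power hs hτ) ?_ u
  rintro _ ⟨κ, hκ, rfl⟩
  simp only [shift_power hs.le hτ _ hκ]
  have : Continuous fun a : ℝ => Complex.exp (a * κ) • power s τ κ := by fun_prop
  exact this.tendsto a₀

theorem continuous_shift (hs : 0 < s) (hτ : 0 ≤ τ) :
    Continuous fun p : ℝ × BSSpace s τ => shift hs.le hτ p.1 p.2 :=
  continuous_clm_apply_of_locally_bounded (fun a₀ => ⟨_, eventually_norm_shift_le hs.le hτ a₀⟩)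
    (continuous_shift_apply hs hτ)

theorem norm_smul_shift_apply_le (hs : 0 ≤ s) (hτ : 0 ≤ τ) (k a : ℝ) (u : BSSpace s τ) :
    ‖k • shift hs hτ a u‖ ≤ |k| * Real.exp ((s + τ) * |a|) * ‖u‖ := by
  rw [norm_smul, Real.norm_eq_abs, mul_assoc]
  gcongr
  exact (shift hs hτ a).le_of_opNorm_le (norm_shift_le hs hτ a) u

theorem integrable_smul_shift (hs : 0 < s) (hτ : 0 ≤ τ) {m : Measure ℝ} {k : ℝ → ℝ}
    (hk : Continuous k) (hi : Integrable (fun a => |k a| * Real.exp ((s + τ) * |a|)) m)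
    (u : BSSpace s τ) : Integrable (fun a => k a • shift hs.le hτ a u) m :=
  (hi.mul_const ‖u‖).mono' (hk.smul (continuous_shift_apply hs hτ u)).aestronglyMeasurable
    (.of_forall fun a => norm_smul_shift_apply_le hs.le hτ (k a) a u)

/-- The average `∫ k(a) S_a dm(a)` of the translations `S_a`. -/
noncomputable def avg (hs : 0 < s) (hτ : 0 ≤ τ) (m : Measure ℝ) (k : ℝ → ℝ) (hk : Continuous k)
    (hi : Integrable (fun a => |k a| * Real.exp ((s + τ) * |a|)) m) :
    BSSpace s τ →L[ℂ] BSSpace s τ :=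
  LinearMap.mkContinuous
    { toFun := fun u => ∫ a, k a • shift hs.le hτ a u ∂m
      map_add' := fun u v => by
        simp only [map_add, smul_add]
        exact integral_add (integrable_smul_shift hs hτ hk hi u) (integrable_smul_shift hs hτ hk hi v)
      map_smul' := fun c u => by
        simp only [map_smul, RingHom.id_apply, smul_comm (_ : ℝ) c]
        exact integral_smul c _ }
    (∫ a, |k a| * Real.exp ((s + τ) * |a|) ∂m) (fun u => by
      rw [← integral_mul_const]
      exact norm_integral_le_of_norm_le (hi.mul_const _)
        (.of_forall fun a => norm_smul_shift_apply_le hs.le hτ (k a) a u))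

theorem norm_avg_le (hs : 0 < s) (hτ : 0 ≤ τ) (m : Measure ℝ) (k : ℝ → ℝ) (hk : Continuous k)
    (hi : Integrable (fun a => |k a| * Real.exp ((s + τ) * |a|)) m) :
    ‖avg hs hτ m k hk hi‖ ≤ ∫ a, |k a| * Real.exp ((s + τ) * |a|) ∂m :=
  LinearMap.mkContinuous_norm_le _ (integral_nonneg fun a => by positivity) _

theorem avg_power (hs : 0 < s) (hτ : 0 ≤ τ) (m : Measure ℝ) (k : ℝ → ℝ) (hk : Continuous k)
    (hi : Integrable (fun a => |k a| * Real.exp ((s + τ) * |a|)) m) {κ : ℂ}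
    (hκ : κ ∈ powerStrip s) :
    avg hs hτ m k hk hi (power s τ κ) = (∫ a, (k a : ℂ) * Complex.exp (a * κ) ∂m) • power s τ κ := by
  have := completeSpace hs hτ
  change ∫ a, k a • shift hs.le hτ a (power s τ κ) ∂m = _
  rw [← integral_smul_const]
  refine integral_congr_ae (.of_forall fun a => ?_)
  simp only
  rw [shift_power hs.le hτ a hκ, ← smul_smul]
  rfl

/-! ### The resolvent of the derivative -/

/-- The resolvent `(c - d/dy)⁻¹` for a real number `c` with `|c| > s + τ`: a Laplace transform of the
translations over the half-line on which `exp (-c a)` decays. -/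
theorem exists_resolvent (hs : 0 < s) (hτ : 0 ≤ τ) {c : ℝ} (hc : s + τ < |c|) :
    ∃ R : BSSpace s τ →L[ℂ] BSSpace s τ, ∀ κ ∈ powerStrip s,
      R (power s τ κ) = ((c : ℂ) - κ)⁻¹ • power s τ κ := by
  have hk : Continuous fun a : ℝ => Real.exp (-c * a) := by fun_prop
  rcases abs_cases c with ⟨h, _⟩ | ⟨h, _⟩
  · rw [h] at hc
    have hi : Integrable (fun a => |Real.exp (-c * a)| * Real.exp ((s + τ) * |a|))
        (volume.restrict (Ioi 0)) := by
      have h1 : IntegrableOn (fun a => Real.exp ((s + τ - c) * a)) (Ioi 0) :=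
        integrableOn_exp_mul_Ioi (by linarith) 0
      refine h1.congr_fun (fun a ha => ?_) measurableSet_Ioi
      simp only
      rw [abs_of_pos (Real.exp_pos _), abs_of_pos ha, ← Real.exp_add]
      congr 1
      ring
    refine ⟨avg hs hτ _ _ hk hi, fun κ hκ => ?_⟩
    rw [avg_power hs hτ _ _ hk hi hκ]
    congr 1
    have hre : (κ - c).re < 0 := by
      have := hκ.2
      simp only [Complex.sub_re, Complex.ofReal_re]
      linarith
    have h2 := integral_exp_mul_complex_Ioi hre 0
    simp only [Complex.ofReal_zero, mul_zero, Complex.exp_zero] at h2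
    rw [show ((c : ℂ) - κ)⁻¹ = -1 / (κ - c) by rw [← neg_sub, inv_neg, neg_div, one_div], ← h2]
    refine integral_congr_ae (.of_forall fun a => ?_)
    simp only [Complex.ofReal_exp]
    rw [← Complex.exp_add]
    congr 1
    push_cast
    ring
  · rw [h] at hc
    have hi : Integrable (fun a => |Real.exp (-c * a)| * Real.exp ((s + τ) * |a|))
        (volume.restrict (Iic 0)) := by
      have h1 : IntegrableOn (fun a => Real.exp ((-c - (s + τ)) * a)) (Iic 0) :=
        integrableOn_exp_mul_Iic (by linarith) 0
      refine h1.congr_fun (fun a ha => ?_) measurableSet_Iic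
      simp only
      rw [abs_of_pos (Real.exp_pos _), abs_of_nonpos ha, ← Real.exp_add]
      congr 1
      ring
    refine ⟨-avg hs hτ _ _ hk hi, fun κ hκ => ?_⟩
    rw [neg_apply, avg_power hs hτ _ _ hk hi hκ, ← neg_smul]
    congr 1
    have hre : 0 < (κ - c).re := by
      have := hκ.1
      simp only [Complex.sub_re, Complex.ofReal_re]
      linarith
    have h2 := integral_exp_mul_complex_Iic hre 0
    simp only [Complex.ofReal_zero, mul_zero, Complex.exp_zero] at h2
    rw [← neg_sub, inv_neg, ← one_div, ← h2]
    congr 1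
    refine integral_congr_ae (.of_forall fun a => ?_)
    simp only [Complex.ofReal_exp]
    rw [← Complex.exp_add]
    congr 1
    push_cast
    ring

/-- Evaluation at a point as a continuous linear functional. -/
noncomputable def logEval (s τ y : ℝ) : BSSpace s τ →L[ℂ] ℂ :=
  LinearMap.mkContinuous
    { toFun := fun u => logFun u y, map_add' := fun _ _ => rfl, map_smul' := fun _ _ => rfl }
    (logWeight s τ y) (fun u => (norm_logFun_le u y).trans_eq (mul_comm _ _))

theorem logEval_apply (y : ℝ) (u : BSSpace s τ) : logEval s τ y u = logFun u y := rfl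

/-- The relation `(c - d/dy) R f = f` extends from the powers to all `f`. -/
theorem hasDerivAt_logFun_resolvent (hs : 0 < s) (hτ : 0 ≤ τ) {c : ℝ} (hc : s + τ < |c|)
    {R : BSSpace s τ →L[ℂ] BSSpace s τ}
    (hR : ∀ κ ∈ powerStrip s, R (power s τ κ) = ((c : ℂ) - κ)⁻¹ • power s τ κ)
    (f : BSSpace s τ) (y : ℝ) :
    HasDerivAt (logFun (R f)) (c * logFun (R f) y - logFun f y) y := by
  have := completeSpace hs hτ
  have hne : ∀ κ ∈ powerStrip s, (c : ℂ) - κ ≠ 0 := by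
    rintro κ ⟨h0, h1⟩ h
    rw [sub_eq_zero] at h
    rw [← h, Complex.ofReal_re] at h0 h1
    rw [abs_of_pos h0] at hc
    linarith
  set g : BSSpace s τ := (c : ℂ) • R f - f with hg
  have h1 : ∀ b, logFun (R f) b = logFun (R f) y + ∫ a in 0..(b - y), logFun g (y + a) := by
    intro b
    have h2 := sub_eq_integral_of_dense_span (continuous_shift hs hτ) (dense_span_power hs hτ)
      (q := fun κ => κ) (t := b - y) (fun κ hκ a _ => shift_power hs.le hτ a hκ) hR hne f
    have h3 := congrArg (logEval s τ y) h2
    rw [← ContinuousLinearMap.intervalIntegral_comp_comm _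
      ((continuous_shift_apply hs hτ _).intervalIntegrable _ _), map_sub] at h3
    simp only [logEval_apply, logFun_shift] at h3
    rw [← h3]
    ring_nf
  have h4 : HasDerivAt (fun t => ∫ a in 0..t, logFun g (y + a)) (logFun g (y + 0)) (y - y) := by
    rw [sub_self]
    have hc' : Continuous fun a => logFun g (y + a) := by fun_prop
    exact intervalIntegral.integral_hasDerivAt_right (hc'.intervalIntegrable _ _)
      (hc'.stronglyMeasurableAtFilter _ _) hc'.continuousAt
  have h5 := (h4.comp_sub_const y y).const_add (logFun (R f) y)
  rw [show c * logFun (R f) y - logFun f y = logFun g (y + 0) by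
    rw [add_zero, hg, logFun_sub, logFun_smul]]
  exact h5.congr_of_eventuallyEq (.of_forall h1)

/-- A number `c` with `|c| > s + τ` is not an eigenvalue of `d/dy`, since `exp (c y)` grows faster than
the weight. -/
theorem eq_zero_of_hasDerivAt_logFun (hs : 0 ≤ s) (hτ : 0 ≤ τ) {c : ℝ} (hc : s + τ < |c|)
    {u : BSSpace s τ} (h : ∀ y, HasDerivAt (logFun u) (c * logFun u y) y) : u = 0 := by
  have hder : ∀ y, HasDerivAt (fun y : ℝ => Complex.exp (-c * y) * logFun u y) 0 y := by
    intro y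
    have h1 : HasDerivAt (fun y : ℝ => Complex.exp (-c * y)) (Complex.exp (-c * y) * -c) y := by
      simpa using ((hasDerivAt_id (y : ℂ)).const_mul (-(c : ℂ))).cexp.comp_ofReal
    refine (h1.mul (h y)).congr_deriv ?_
    ring
  have hconst : ∀ y : ℝ, logFun u y = Complex.exp (c * y) * logFun u 0 := by
    intro y
    have h1 := is_const_of_deriv_eq_zero (fun y => (hder y).differentiableAt)
      (fun y => (hder y).deriv) y 0
    simp only [Complex.ofReal_zero, mul_zero, Complex.exp_zero, one_mul] at h1
    rw [← h1, ← mul_assoc, ← Complex.exp_add]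
    simp
  have hb : ∀ t : ℝ, 0 ≤ t → Real.exp ((|c| - (s + τ)) * t) * ‖logFun u 0‖ ≤
      ‖u‖ * logWeight s τ 0 := by
    intro t ht
    obtain ⟨y, hy, hyc⟩ : ∃ y : ℝ, |y| = t ∧ c * y = |c| * t := by
      rcases abs_cases c with ⟨h, _⟩ | ⟨h, _⟩
      · exact ⟨t, abs_of_nonneg ht, by rw [h]⟩
      · exact ⟨-t, by rw [abs_neg, abs_of_nonneg ht], by rw [h]; ring⟩
    have h1 := norm_logFun_le u y
    rw [hconst y, norm_mul, norm_cexp_mul_ofReal, Complex.ofReal_re, hyc] at h1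
    have h2 := logWeight_add_le hs hτ 0 y
    rw [zero_add, hy] at h2
    have h3 : Real.exp (|c| * t) * ‖logFun u 0‖ ≤
        Real.exp ((s + τ) * t) * (‖u‖ * logWeight s τ 0) := by
      have := mul_le_mul_of_nonneg_left h2 (norm_nonneg u)
      linarith
    rw [sub_mul, Real.exp_sub, div_mul_eq_mul_div, div_le_iff₀ (Real.exp_pos _)]
    linarith
  have h0 : logFun u 0 = 0 := by
    by_contra hne
    have hpos := norm_pos_iff.2 hne
    have h1 : Tendsto (fun t : ℝ => Real.exp ((|c| - (s + τ)) * t) * ‖logFun u 0‖) atTop atTop :=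
      (Real.tendsto_exp_atTop.comp (tendsto_id.const_mul_atTop (sub_pos.2 hc))).atTop_mul_const hpos
    obtain ⟨t, ht, ht'⟩ := ((h1.eventually (eventually_gt_atTop (‖u‖ * logWeight s τ 0))).and
      (eventually_ge_atTop 0)).exists
    exact absurd (hb t ht') (not_le.2 ht)
  refine logFun_injective (funext fun y => ?_)
  rw [hconst y, h0, mul_zero, logFun_zero]

/-! ### The diffusion semigroup -/

section Diffusion

open ProbabilityTheory

/-- The symbol `D κ² + b κ - r` of the operator `D d²/dy² + b d/dy - r`. -/
noncomputable def diffusionSymbol (D : ℝ≥0) (b r : ℝ) (κ : ℂ) : ℂ :=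
  ((D : ℝ) : ℂ) * κ ^ 2 + b * κ - r

theorem exp_mul_abs_le (ω a : ℝ) :
    Real.exp (ω * |a|) ≤ Real.exp (ω * a) + Real.exp (-ω * a) := by
  rcases abs_cases a with ⟨h, _⟩ | ⟨h, _⟩
  · rw [h]; linarith [Real.exp_pos (-ω * a)]
  · rw [h, mul_neg, ← neg_mul]; linarith [Real.exp_pos (ω * a)]

theorem integrable_gaussianReal_exp_abs (s τ m : ℝ) (v : ℝ≥0) :
    Integrable (fun a => |(1 : ℝ)| * Real.exp ((s + τ) * |a|)) (gaussianReal m v) := by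
  refine ((integrable_exp_mul_gaussianReal (s + τ)).add
    (integrable_exp_mul_gaussianReal (-(s + τ)))).mono' (by fun_prop) (.of_forall fun a => ?_)
  rw [abs_one, one_mul, Real.norm_of_nonneg (Real.exp_pos _).le]
  exact exp_mul_abs_le _ _

/-- The operator `exp (t (D d²/dy² + b d/dy - r))`: the translations are averaged over a normal
distribution with mean `b t` and variance `2 D t`, and the result is discounted. -/
noncomputable def diffusionOp (hs : 0 < s) (hτ : 0 ≤ τ) (D : ℝ≥0) (b r : ℝ) (t : ℝ≥0) :
    BSSpace s τ →L[ℂ] BSSpace s τ :=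
  Complex.exp ((-r * t : ℝ)) • avg hs hτ (gaussianReal (b * t) (2 * D * t)) (fun _ => 1)
    continuous_const (integrable_gaussianReal_exp_abs _ _ _ _)

theorem diffusionOp_power (hs : 0 < s) (hτ : 0 ≤ τ) (D : ℝ≥0) (b r : ℝ) (t : ℝ≥0) {κ : ℂ}
    (hκ : κ ∈ powerStrip s) : diffusionOp hs hτ D b r t (power s τ κ) =
      Complex.exp ((t : ℝ) * diffusionSymbol D b r κ) • power s τ κ := by
  rw [diffusionOp, smul_apply, avg_power hs hτ _ _ _ _ hκ, smul_smul]
  congr 1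
  have h := complexMGF_gaussianReal (X := id) (p := gaussianReal (b * t) (2 * D * t))
    (Measure.map_id) κ
  rw [complexMGF] at h
  have e : ∫ a, ((1 : ℝ) : ℂ) * Complex.exp (a * κ) ∂(gaussianReal (b * t) (2 * D * t)) =
      ∫ a, Complex.exp (κ * (id a : ℝ)) ∂(gaussianReal (b * t) (2 * D * t)) :=
    integral_congr_ae (.of_forall fun a => by simp [mul_comm])
  rw [e, h, ← Complex.exp_add, diffusionSymbol]
  congr 1
  push_cast
  ring

theorem norm_diffusionOp_le (hs : 0 < s) (hτ : 0 ≤ τ) (D : ℝ≥0) (b r : ℝ) (t : ℝ≥0) :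
    ‖diffusionOp hs hτ D b r t‖ ≤
      2 * Real.exp (((s + τ) * |b| + D * (s + τ) ^ 2 - r) * t) := by
  set ω := s + τ with hω
  have hω0 : 0 ≤ ω := by positivity
  have hmgf : ∀ c : ℝ, ∫ a, Real.exp (c * a) ∂(gaussianReal (b * t) (2 * D * t)) =
      Real.exp (b * t * c + (2 * D * t : ℝ≥0) * c ^ 2 / 2) := by
    intro c
    exact mgf_gaussianReal (X := id) (p := gaussianReal (b * t) (2 * D * t)) Measure.map_id c
  have h1 : ∫ a, |(1 : ℝ)| * Real.exp (ω * |a|) ∂(gaussianReal (b * t) (2 * D * t)) ≤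
      2 * Real.exp ((ω * |b| + D * ω ^ 2) * t) := by
    calc _ ≤ ∫ a, (Real.exp (ω * a) + Real.exp (-ω * a)) ∂(gaussianReal (b * t) (2 * D * t)) := by
          refine integral_mono (integrable_gaussianReal_exp_abs _ _ _ _)
            ((integrable_exp_mul_gaussianReal _).add (integrable_exp_mul_gaussianReal _)) fun a => ?_
          simp only [abs_one, one_mul]
          exact exp_mul_abs_le _ _
      _ = Real.exp (b * t * ω + (2 * D * t : ℝ≥0) * ω ^ 2 / 2) +
            Real.exp (b * t * (-ω) + (2 * D * t : ℝ≥0) * (-ω) ^ 2 / 2) := by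
          rw [integral_add (integrable_exp_mul_gaussianReal _) (integrable_exp_mul_gaussianReal _),
            hmgf, hmgf]
      _ ≤ Real.exp ((ω * |b| + D * ω ^ 2) * t) + Real.exp ((ω * |b| + D * ω ^ 2) * t) := by
          have hb1 : b * (ω * t) ≤ |b| * (ω * t) :=
            mul_le_mul_of_nonneg_right (le_abs_self b) (by positivity)
          have hb2 : -b * (ω * t) ≤ |b| * (ω * t) :=
            mul_le_mul_of_nonneg_right (neg_le_abs b) (by positivity)
          push_cast
          refine add_le_add (Real.exp_le_exp.2 ?_) (Real.exp_le_exp.2 ?_) <;> linarith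
      _ = _ := by ring
  rw [diffusionOp, norm_smul, ← Complex.ofReal_exp, Complex.norm_real,
    Real.norm_of_nonneg (Real.exp_pos _).le]
  calc _ ≤ Real.exp (-r * t) * (2 * Real.exp ((ω * |b| + D * ω ^ 2) * t)) := by
        gcongr
        exact (norm_avg_le hs hτ _ _ _ _).trans h1
    _ = _ := by
        rw [mul_left_comm, ← Real.exp_add]; congr 2; ring

/-- The semigroup generated by `D d²/dy² + b d/dy - r`. Its algebraic and continuity properties are
inherited from the action on the powers. -/
noncomputable def diffusion (hs : 0 < s) (hτ : 0 ≤ τ) (D : ℝ≥0) (b r : ℝ) :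
    C0Semigroup (BSSpace s τ) where
  op := diffusionOp hs hτ D b r
  op_zero := by
    refine ContinuousLinearMap.ext_on (dense_span_power hs hτ) ?_
    rintro _ ⟨κ, hκ, rfl⟩
    rw [diffusionOp_power hs hτ D b r 0 hκ]
    simp
  op_add t t' := by
    refine ContinuousLinearMap.ext_on (dense_span_power hs hτ) ?_
    rintro _ ⟨κ, hκ, rfl⟩
    rw [ContinuousLinearMap.comp_apply, diffusionOp_power hs hτ D b r _ hκ,
      diffusionOp_power hs hτ D b r _ hκ, map_smul, diffusionOp_power hs hτ D b r _ hκ, smul_smul,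
      ← Complex.exp_add]
    congr 2
    push_cast
    ring
  continuous_orbit u := by
    rw [continuous_iff_continuousAt]
    intro t₀
    have hc : Continuous fun t : ℝ≥0 =>
        2 * Real.exp (((s + τ) * |b| + D * (s + τ) ^ 2 - r) * t) := by fun_prop
    refine tendsto_clm_apply_of_dense_span 
      (M := 2 * Real.exp (((s + τ) * |b| + D * (s + τ) ^ 2 - r) * t₀) + 1) ?_ (dense_span_power hs hτ) ?_ u
    · filter_upwards [(hc.tendsto t₀).eventually (ge_mem_nhds (lt_add_one _))] with t ht
      exact (norm_diffusionOp_le hs hτ D b r t).trans ht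
    · rintro _ ⟨κ, hκ, rfl⟩
      simp only [diffusionOp_power hs hτ D b r _ hκ]
      have : Continuous fun t : ℝ≥0 =>
          Complex.exp ((t : ℝ) * diffusionSymbol D b r κ) • power s τ κ := by fun_prop
      exact this.tendsto t₀

end Diffusion

end BSSpace

/-- An operator acting on a total set of eigenvectors of a semigroup as the resolvent `(c - A)⁻¹` maps
into the domain of the generator `A`. -/
theorem C0Semigroup.mem_generator_of_resolvent {X : Type*} [NormedAddCommGroup X] [NormedSpace ℂ X]
    [CompleteSpace X] (T : C0Semigroup X) {M : ℝ → ℝ} (hMc : Continuous M)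
    (hM : ∀ t : ℝ≥0, ‖T.op t‖ ≤ M t) {Ω : Set ℂ} {e : ℂ → X}
    (hd : Dense (Submodule.span ℂ (e '' Ω) : Set X)) {q : ℂ → ℂ}
    (heig : ∀ z ∈ Ω, ∀ t : ℝ≥0, T.op t (e z) = Complex.exp ((t : ℝ) * q z) • e z)
    {R : X →L[ℂ] X} {c : ℂ} (hR : ∀ z ∈ Ω, R (e z) = (c - q z)⁻¹ • e z)
    (hc : ∀ z ∈ Ω, c - q z ≠ 0) (f : X) : (R f, c • R f - f) ∈ T.generator := by
  rw [T.mem_generator_iff]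
  have hP : Continuous fun p : ℝ × X => T.op p.1.toNNReal p.2 := by
    refine continuous_clm_apply_of_locally_bounded (P := fun t : ℝ => T.op t.toNNReal)
      (fun t₀ => ⟨M t₀.toNNReal + 1, ?_⟩)
      (fun x => (T.continuous_orbit x).comp continuous_real_toNNReal)
    have h : Continuous fun t : ℝ => M t.toNNReal := by fun_prop
    filter_upwards [(h.tendsto t₀).eventually (ge_mem_nhds (lt_add_one _))] with t ht
    exact (hM _).trans ht
  set g := c • R f - f
  have hcont : Continuous fun t : ℝ => T.op t.toNNReal g :=
    (T.continuous_orbit g).comp continuous_real_toNNReal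
  have h1 : HasDerivAt (fun t : ℝ => R f + ∫ a in 0..t, T.op a.toNNReal g)
      (T.op (0 : ℝ).toNNReal g) 0 :=
    (intervalIntegral.integral_hasDerivAt_right (hcont.intervalIntegrable _ _)
      (hcont.stronglyMeasurableAtFilter _ _) hcont.continuousAt).const_add _
  rw [Real.toNNReal_zero, T.op_zero, ContinuousLinearMap.id_apply] at h1
  refine h1.hasDerivWithinAt.congr_of_mem (fun t ht => ?_) self_mem_Ici
  have h2 := sub_eq_integral_of_dense_span (P := fun t : ℝ => T.op t.toNNReal) (t := t) hP hd
    (q := q) (fun z hz a ha => by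
      rw [uIcc_of_le ht] at ha
      rw [heig z hz, Real.coe_toNNReal _ ha.1]) hR hc f
  rw [← h2]
  abel

namespace BSSpace

variable {s τ : ℝ}

/-! ### The Black–Scholes operator in the logarithmic variable -/

theorem mem_bsD_iff {ν : ℝ} (hν : ν ≠ 0) {u v : BSSpace s τ} :
    (u, v) ∈ bsD ν s τ ↔ ∀ y, HasDerivAt (logFun u) ((ν : ℂ)⁻¹ * logFun v y) y := by
  have hν' : (ν : ℂ) ≠ 0 := by exact_mod_cast hν
  constructor
  · intro h y
    obtain ⟨d, hd, hv⟩ := h (expPt y)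
    have h1 := HasDerivAt.scomp y (h := Real.exp) (h' := Real.exp y) hd (Real.hasDerivAt_exp y)
    have e : (fun z : ℝ => if hz : 0 < z then u ⟨z, hz⟩ else 0) ∘ Real.exp = logFun u := by
      ext z
      simp only [Function.comp_apply, Real.exp_pos, dif_pos]
      rfl
    simp only at h1
    rw [e] at h1
    refine h1.congr_deriv ?_
    change Real.exp y • d = (ν : ℂ)⁻¹ * v (expPt y)
    simp only at hv
    rw [hv, Complex.real_smul, mul_assoc, inv_mul_cancel_left₀ hν']
    rfl
  · intro h x
    have hx : (0 : ℝ) < x := x.2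
    refine ⟨(x : ℝ)⁻¹ • ((ν : ℂ)⁻¹ * logFun v (Real.log x)), ?_, ?_⟩
    · have h1 := HasDerivAt.scomp (x : ℝ) (h := Real.log) (h' := (x : ℝ)⁻¹) (h (Real.log x))
        (Real.hasDerivAt_log hx.ne')
      refine h1.congr_of_eventuallyEq ?_
      filter_upwards [lt_mem_nhds hx] with z hz
      simp only [hz, dif_pos, Function.comp_apply]
      exact val_eq_logFun u ⟨z, hz⟩
    · simp only
      rw [val_eq_logFun, Complex.real_smul, Complex.ofReal_inv]
      have : ((x : ℝ) : ℂ) ≠ 0 := by exact_mod_cast hx.ne'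
      field_simp

/-- The Black–Scholes operator is the generator of the diffusion semigroup: both have the same resolvent
at a sufficiently large real number `c`, for which `c - g(ν κ)` splits into two real linear factors
with roots outside the range of growth of the translations. -/
theorem generator_diffusion (hs : 0 < s) (hτ : 0 ≤ τ) {ν : ℝ} (hν : 0 < ν) (γ r : ℝ) :
    (diffusion hs hτ (ν ^ 2).toNNReal (γ * ν) r : C0Semigroup (BSSpace s τ)).generator =
      bsOperator ν γ r s τ := by
  have := completeSpace (s := s) (τ := τ) hs hτ
  set T : C0Semigroup (BSSpace s τ) := diffusion hs hτ (ν ^ 2).toNNReal (γ * ν) r with hT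
  have hD : (((ν ^ 2).toNNReal : ℝ≥0) : ℝ) = ν ^ 2 := Real.coe_toNNReal _ (by positivity)
  set ω := s + τ with hω
  have hω0 : 0 ≤ ω := by positivity
  have hνC : (ν : ℂ) ≠ 0 := by exact_mod_cast hν.ne'
  -- the two roots of `ν² κ² + γ ν κ - r = c`
  set κ₁ : ℝ := ω + 2 * (|γ| / ν) + 1 with hκ₁
  set κ₂ : ℝ := -(γ / ν) - κ₁ with hκ₂
  set c : ℝ := ν ^ 2 * κ₁ ^ 2 + γ * ν * κ₁ - r with hc
  have hγ0 : 0 ≤ |γ| / ν := by positivity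
  have hγ1 : -(γ / ν) ≤ |γ| / ν := by
    rw [← neg_div]; exact div_le_div_of_nonneg_right (neg_le_abs γ) hν.le
  have h₁ : ω < |κ₁| := by
    rw [abs_of_pos (by positivity)]; linarith
  have h₂ : ω < |κ₂| := by
    rw [abs_of_neg (by linarith)]; linarith
  have hfactor : ∀ κ : ℂ, (c : ℂ) - diffusionSymbol (ν ^ 2).toNNReal (γ * ν) r κ =
      -(ν : ℂ) ^ 2 * (((κ₁ : ℂ) - κ) * ((κ₂ : ℂ) - κ)) := by
    intro κ
    rw [diffusionSymbol, hD, hκ₂, hc]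
    push_cast
    field_simp
    ring
  obtain ⟨R₁, hR₁⟩ := exists_resolvent hs hτ h₁
  obtain ⟨R₂, hR₂⟩ := exists_resolvent hs hτ h₂
  set R : BSSpace s τ →L[ℂ] BSSpace s τ := (-((ν : ℂ) ^ 2)⁻¹) • R₁.comp R₂ with hRdef
  have hne : ∀ κ ∈ powerStrip s, (c : ℂ) - diffusionSymbol (ν ^ 2).toNNReal (γ * ν) r κ ≠ 0 := by
    rintro κ ⟨k0, k1⟩
    rw [hfactor]
    refine mul_ne_zero (neg_ne_zero.2 (pow_ne_zero 2 hνC)) (mul_ne_zero ?_ ?_) <;>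
    · intro h
      rw [sub_eq_zero] at h
      rw [← h, Complex.ofReal_re] at k0 k1
      first
        | (rw [abs_of_pos k0] at h₁; linarith)
        | (rw [abs_of_pos k0] at h₂; linarith)
  have hR : ∀ κ ∈ powerStrip s, R (power s τ κ) =
      ((c : ℂ) - diffusionSymbol (ν ^ 2).toNNReal (γ * ν) r κ)⁻¹ • power s τ κ := by
    intro κ hκ
    rw [hfactor, hRdef, smul_apply, ContinuousLinearMap.comp_apply, hR₂ κ hκ, map_smul, hR₁ κ hκ,
      smul_smul, smul_smul, mul_inv, mul_inv, inv_neg]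
    congr 1
    ring
  have hgen : ∀ f, (R f, (c : ℂ) • R f - f) ∈ T.generator := fun f =>
    T.mem_generator_of_resolvent (M := fun t => 2 * Real.exp (((s + τ) * |γ * ν| +
      ((ν ^ 2).toNNReal : ℝ≥0) * (s + τ) ^ 2 - r) * t)) (by fun_prop)
      (fun t => norm_diffusionOp_le hs hτ _ _ _ t) (dense_span_power hs hτ)
      (fun κ hκ t => diffusionOp_power hs hτ _ _ _ t hκ) hR hne f
  -- `R f` lies in the domain of the Black–Scholes operator
  have hdom : ∀ f, (R f, (c : ℂ) • R f - f) ∈ bsOperator ν γ r s τ := by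
    intro f
    have hg := hasDerivAt_logFun_resolvent hs hτ h₂ hR₂ f
    have hu := hasDerivAt_logFun_resolvent hs hτ h₁ hR₁ (R₂ f)
    set g := R₂ f
    set u := R₁ g
    have hRf : R f = (-((ν : ℂ) ^ 2)⁻¹) • u := rfl
    refine ⟨(-(ν : ℂ)⁻¹) • ((κ₁ : ℂ) • u - g),
      (-1 : ℂ) • ((κ₁ : ℂ) • ((κ₁ : ℂ) • u - g) - ((κ₂ : ℂ) • g - f)), ?_, ?_, ?_⟩
    · rw [mem_bsD_iff hν.ne']
      intro y
      rw [hRf, logFun_smul]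
      refine ((hu y).const_mul _).congr_deriv ?_
      simp only [logFun_smul, logFun_sub]
      field_simp
    · rw [mem_bsD_iff hν.ne']
      intro y
      rw [logFun_smul, logFun_sub, logFun_smul]
      refine ((((hu y).const_mul _).sub (hg y)).const_mul _).congr_deriv ?_
      simp only [logFun_smul, logFun_sub]
      field_simp
    · simp only [hRf]
      apply logFun_injective
      ext y
      simp only [logFun_smul, logFun_sub, logFun_add, hc, hκ₂]
      push_cast
      field_simp
      ring
  -- `c` is not an eigenvalue of the Black–Scholes operator
  have hinj : ∀ d, (d, (c : ℂ) • d) ∈ bsOperator ν γ r s τ → d = 0 := by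
    rintro d ⟨v, w, hv, hw, e⟩
    rw [mem_bsD_iff hν.ne'] at hv hw
    have e' : ∀ y, (c : ℂ) * logFun d y = logFun w y + γ * logFun v y - r * logFun d y := by
      intro y
      exact congrFun (congrArg logFun e) y
    -- `(d/dy - κ₁) (d/dy - κ₂) d = 0`
    have h3 : v - ((ν : ℂ) * κ₂) • d = 0 := by
      refine eq_zero_of_hasDerivAt_logFun hs.le hτ h₁ fun y => ?_
      rw [logFun_sub, logFun_smul]
      refine ((hw y).sub ((hv y).const_mul _)).congr_deriv ?_
      have hw' : logFun w y = (c : ℂ) * logFun d y - γ * logFun v y + r * logFun d y := by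
        rw [e' y]; ring
      simp only [hw', hc, hκ₂]
      push_cast
      field_simp
      ring
    refine eq_zero_of_hasDerivAt_logFun hs.le hτ h₂ fun y => (hv y).congr_deriv ?_
    rw [sub_eq_zero.1 h3, logFun_smul]
    field_simp
  have hsub : ∀ {p q : BSSpace s τ × BSSpace s τ}, p ∈ bsOperator ν γ r s τ →
      q ∈ bsOperator ν γ r s τ → p - q ∈ bsOperator ν γ r s τ := by
    rintro p q ⟨v, w, hv, hw, e⟩ ⟨v', w', hv', hw', e'⟩
    rw [mem_bsD_iff hν.ne'] at hv hw hv' hw'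
    refine ⟨v - v', w - w', ?_, ?_, ?_⟩
    · refine (mem_bsD_iff hν.ne').2 fun y => ?_
      rw [logFun_sub, mul_sub]
      exact (hv y).sub (hv' y)
    · refine (mem_bsD_iff hν.ne').2 fun y => ?_
      rw [logFun_sub, mul_sub]
      exact (hw y).sub (hw' y)
    · rw [Prod.snd_sub, Prod.fst_sub, e, e']
      module
  have hMc : (s + τ) * |γ * ν| + ((ν ^ 2).toNNReal : ℝ≥0) * (s + τ) ^ 2 - r < c := by
    have e1 : |γ * ν| = |γ| / ν * ν ^ 2 := by
      rw [abs_mul, abs_of_pos hν]; field_simp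
    have e2 : γ * ν = -(-(γ / ν)) * ν ^ 2 := by field_simp
    rw [hD, e1, hc, e2, ← hω, hκ₁]
    generalize |γ| / ν = δ at *
    generalize -(γ / ν) = ε at *
    have hν2 : 0 < ν ^ 2 := by positivity
    have h5 : ω * δ + ω ^ 2 < (ω + 2 * δ + 1) ^ 2 - δ * (ω + 2 * δ + 1) := by nlinarith
    have h6 : ε * (ω + 2 * δ + 1) ≤ δ * (ω + 2 * δ + 1) :=
      mul_le_mul_of_nonneg_right hγ1 (by positivity)
    nlinarith
  ext ⟨u, v⟩
  constructor
  · intro huv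
    set f := (c : ℂ) • u - v with hf
    have h1 := hgen f
    have h2 : (u - R f, (c : ℂ) • (u - R f)) ∈ T.generator := by
      rw [T.mem_generator_iff] at huv h1 ⊢
      have h := huv.sub h1
      rw [show v - ((c : ℂ) • R f - f) = (c : ℂ) • (u - R f) by rw [hf, smul_sub]; abel] at h
      exact h.congr (fun x _ => map_sub _ _ _) (map_sub _ _ _)
    have h3 : u - R f = 0 := by
      -- the semigroup grows more slowly than `exp (c t)`
      set M := (s + τ) * |γ * ν| + ((ν ^ 2).toNNReal : ℝ≥0) * (s + τ) ^ 2 - r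
      have hcM : 0 < c - M := sub_pos.2 hMc
      by_contra h
      set t : ℝ≥0 := ⟨(c - M)⁻¹, (inv_pos.2 hcM).le⟩ with ht
      have ht' : (t : ℝ) = (c - M)⁻¹ := rfl
      have h5 : ‖T.op t (u - R f)‖ ≤ 2 * Real.exp (M * t) * ‖u - R f‖ :=
        (T.op t).le_of_opNorm_le (norm_diffusionOp_le hs hτ _ _ _ t) _
      rw [T.op_apply_of_mem_generator h2, norm_smul, Complex.norm_exp] at h5
      have h6 := le_of_mul_le_mul_right h5 (norm_pos_iff.2 h)
      have h7 : ((c : ℂ) * ((t : ℝ) : ℂ)).re = (c - M) * t + M * t := by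
        rw [← Complex.ofReal_mul, Complex.ofReal_re]; ring
      rw [h7, Real.exp_add, ht', mul_inv_cancel₀ hcM.ne'] at h6
      linarith [le_of_mul_le_mul_right h6 (Real.exp_pos _), Real.exp_one_gt_d9]
    rw [sub_eq_zero] at h3
    have h4 := hdom f
    rw [← h3, hf, sub_sub_cancel] at h4
    exact h4
  · intro huv
    set f := (c : ℂ) • u - v with hf
    have h1 := hdom f
    have h2 : (u - R f, (c : ℂ) • (u - R f)) ∈ bsOperator ν γ r s τ := by
      have := hsub huv h1
      rwa [Prod.mk_sub_mk, show v - ((c : ℂ) • R f - f) = (c : ℂ) • (u - R f) by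
        rw [hf, smul_sub]; abel] at this
    have h3 := hinj _ h2
    rw [sub_eq_zero] at h3
    have h4 := hgen f
    rw [← h3, hf, sub_sub_cancel] at h4
    exact h4

end BSSpace

/-! ### Holomorphic eigenvector fields -/

section EigenvectorField

variable {X : Type*} [NormedAddCommGroup X] [NormedSpace ℂ X]
  {U : Set ℂ} {F : ℂ → X}

/-- By the identity theorem, the values of a total holomorphic field along a segment of the imaginary
axis are total. -/
theorem eq_zero_of_forall_mem_Ioo_imaginary (hU : IsOpen U) (hUc : IsPreconnected U)
    (hF : DifferentiableOn ℂ F U) (htotal : ∀ φ : X →L[ℂ] ℂ, (∀ z ∈ U, φ (F z) = 0) → φ = 0)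
    {a b : ℝ} (hab : a < b) (hJ : ∀ t ∈ Ioo a b, (t : ℂ) * Complex.I ∈ U) (φ : X →L[ℂ] ℂ)
    (h : ∀ t ∈ Ioo a b, φ (F (t * Complex.I)) = 0) : φ = 0 := by
  obtain ⟨t₀, ht₀⟩ := nonempty_Ioo.2 hab
  have ha : AnalyticOnNhd ℂ (fun z => φ (F z)) U :=
    (φ.differentiable.comp_differentiableOn hF).analyticOnNhd hU
  have hc : Continuous fun t : ℝ => (t : ℂ) * Complex.I := by fun_prop
  have ht : Tendsto (fun t : ℝ => (t : ℂ) * Complex.I) (𝓝[≠] t₀) (𝓝[≠] (t₀ * Complex.I)) := by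
    refine tendsto_nhdsWithin_iff.2 ⟨(hc.tendsto t₀).mono_left nhdsWithin_le_nhds, ?_⟩
    filter_upwards [self_mem_nhdsWithin] with t ht e
    exact ht (by exact_mod_cast mul_right_cancel₀ Complex.I_ne_zero e)
  have hev : ∀ᶠ t : ℝ in 𝓝[≠] t₀, φ (F (t * Complex.I)) = 0 :=
    nhdsWithin_le_nhds (by filter_upwards [Ioo_mem_nhds ht₀.1 ht₀.2] with t ht using h t ht)
  exact htotal φ fun z hz =>
    ha.eqOn_zero_of_preconnected_of_frequently_eq_zero hUc (hJ t₀ ht₀) (ht.frequently hev.frequently) hz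

theorem hasC2ImaginaryEigenfields_of_differentiableOn [CompleteSpace X] {A : Set (X × X)} (hU : IsOpen U)
    (hUc : IsPreconnected U) (hF : DifferentiableOn ℂ F U)
    (htotal : ∀ φ : X →L[ℂ] ℂ, (∀ z ∈ U, φ (F z) = 0) → φ = 0)
    (heig : ∀ z ∈ U, (F z, z • F z) ∈ A) {a b : ℝ} (hab : a < b)
    (hJ : ∀ t ∈ Icc a b, (t : ℂ) * Complex.I ∈ U) : HasC2ImaginaryEigenfields A := by
  refine ⟨Unit, fun _ => Icc a b, fun _ t => F (t * Complex.I),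
    fun _ => ⟨ordConnected_Icc, by rwa [interior_Icc, nonempty_Ioo]⟩, fun _ => ?_, fun _ t ht => ?_, ?_⟩
  · have h1 : ContDiffOn ℝ 2 F U := (hF.contDiffOn hU).restrict_scalars ℝ
    have h2 : ContDiff ℝ 2 fun t : ℝ => (t : ℂ) * Complex.I :=
      Complex.ofRealCLM.contDiff.mul contDiff_const
    exact h1.comp h2.contDiffOn hJ
  · rw [mul_comm Complex.I]
    exact heig _ (hJ t ht)
  · refine dense_span_of_forall_dual fun φ hφ => ?_
    exact eq_zero_of_forall_mem_Ioo_imaginary hU hUc hF htotal hab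
      (fun t ht => hJ t (Ioo_subset_Icc_self ht)) φ
      fun t ht => hφ _ ⟨(), t, Ioo_subset_Icc_self ht, rfl⟩

/-- The eigenvector field on the segment `[a i, b i]` of the imaginary axis is cut off by the factor
`(t - a) (b - t)`, which makes its Fourier coefficients summable and keeps it total. -/
theorem exists_isInvariantMixingFullSupport_of_differentiableOn [CompleteSpace X]
    [SecondCountableTopology X] [MeasurableSpace X] [BorelSpace X] (T : C0Semigroup X) (hU : IsOpen U)
    (hUc : IsPreconnected U) (hF : DifferentiableOn ℂ F U)
    (htotal : ∀ φ : X →L[ℂ] ℂ, (∀ z ∈ U, φ (F z) = 0) → φ = 0)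
    (heig : ∀ z ∈ U, (F z, z • F z) ∈ T.generator) {a b : ℝ} (hab : a < b)
    (hJ : ∀ t ∈ Icc a b, (t : ℂ) * Complex.I ∈ U) : ∃ μ, IsInvariantMixingFullSupport T μ := by
  have hline : ∀ t : ℝ, HasDerivAt (fun t : ℝ => (t : ℂ) * Complex.I) Complex.I t := fun t => by
    simpa using (Complex.ofRealCLM.hasDerivAt (x := t)).mul_const Complex.I
  have hder : ∀ {G : ℂ → X}, DifferentiableOn ℂ G U → ∀ t ∈ Icc a b,
      HasDerivAt (fun t : ℝ => G (t * Complex.I)) (Complex.I • deriv G (t * Complex.I)) t := by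
    intro G hG t ht
    exact ((hG.differentiableAt (hU.mem_nhds (hJ t ht))).hasDerivAt).scomp t (hline t)
  have hF1 := hF.deriv hU
  have hF2 := hF1.deriv hU
  have hp : ∀ t : ℝ, HasDerivAt (fun t => (t - a) * (b - t)) (a + b - 2 * t) t := fun t => by
    refine (((hasDerivAt_id t).sub_const a).mul ((hasDerivAt_id t).const_sub b)).congr_deriv ?_
    simp only [id]; ring
  have hp' : ∀ t : ℝ, HasDerivAt (fun t => a + b - 2 * t) (-2) t := fun t => by
    simpa using ((hasDerivAt_id t).const_mul 2).const_sub (a + b)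
  have hline_cont : Continuous fun t : ℝ => (t : ℂ) * Complex.I := by fun_prop
  have hcont : ∀ {G : ℂ → X}, DifferentiableOn ℂ G U →
      ContinuousOn (fun t : ℝ => G (t * Complex.I)) (Icc a b) := fun hG =>
    hG.continuousOn.comp hline_cont.continuousOn hJ
  refine exists_isInvariantMixingFullSupport T hab
    (F := fun t => ((t - a) * (b - t)) • F (t * Complex.I))
    (F' := fun t => ((t - a) * (b - t)) • (Complex.I • deriv F (t * Complex.I)) +
      (a + b - 2 * t) • F (t * Complex.I))
    (F'' := fun t => (((t - a) * (b - t)) •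
        (Complex.I • (Complex.I • deriv (deriv F) (t * Complex.I))) +
        (a + b - 2 * t) • (Complex.I • deriv F (t * Complex.I))) +
      ((a + b - 2 * t) • (Complex.I • deriv F (t * Complex.I)) + (-2 : ℝ) • F (t * Complex.I)))
    (fun t ht => (hp t).smul (hder hF t ht))
    (fun t ht => ((hp t).smul ((hder hF1 t ht).const_smul Complex.I)).add
      ((hp' t).smul (hder hF t ht))) ?_ (by simp) (by simp) ?_ ?_
  · have h0 := hcont hF
    have h1 := hcont hF1
    have h2 := hcont hF2
    have hq : ContinuousOn (fun t : ℝ => (t - a) * (b - t)) (Icc a b) := by fun_prop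
    have hq' : ContinuousOn (fun t : ℝ => a + b - 2 * t) (Icc a b) := by fun_prop
    refine ((hq.smul ((h2.const_smul _).const_smul _)).add
      (hq'.smul (h1.const_smul _))).add
      ((hq'.smul (h1.const_smul _)).add (h0.const_smul _))
  · intro t ht h
    rw [ContinuousLinearMap.map_smul_of_tower, T.op_apply_of_mem_generator (heig _ (hJ t ht)), smul_comm]
    congr 2
    push_cast
    ring_nf
  · intro φ hφ
    refine eq_zero_of_forall_mem_Ioo_imaginary hU hUc hF htotal hab
      (fun t ht => hJ t (Ioo_subset_Icc_self ht)) φ fun t ht => ?_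
    have h := hφ t (Ioo_subset_Icc_self ht)
    rw [ContinuousLinearMap.map_smul_of_tower] at h
    refine (smul_eq_zero.1 h).resolve_left (mul_pos ?_ ?_).ne'
    · linarith [ht.1]
    · linarith [ht.2]

end EigenvectorField

/-! ### The eigenvectors of the Black–Scholes operator -/

namespace BSSpace

variable {ν s τ : ℝ}

/-- The function `x ^ (z / ν)`; it belongs to `Y^{s,τ}` for `z` in the strip `0 < Re z < s ν`, and is set
to zero outside this strip. -/
noncomputable def eigenvector (ν s τ : ℝ) (z : ℂ) : BSSpace s τ := power s τ (z / ν)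

theorem div_mem_powerStrip_iff (hν : 0 < ν) {z : ℂ} : z / ν ∈ powerStrip s ↔ z ∈ bsStrip ν s := by
  simp only [powerStrip, bsStrip, mem_ofPred_eq, Complex.div_ofReal_re]
  rw [div_lt_iff₀ hν, lt_div_iff₀ hν, zero_mul]

theorem isOpen_bsStrip (ν s : ℝ) : IsOpen (bsStrip ν s) :=
  (isOpen_lt continuous_const Complex.continuous_re).inter
    (isOpen_lt Complex.continuous_re continuous_const)

theorem isPreconnected_bsStrip (ν s : ℝ) : IsPreconnected (bsStrip ν s) :=
  ((convex_halfSpace_re_gt 0).inter (convex_halfSpace_re_lt (s * ν))).isPreconnected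

theorem logFun_eigenvector (hν : 0 < ν) (hτ : 0 ≤ τ) {z : ℂ} (hz : z ∈ bsStrip ν s) (y : ℝ) :
    logFun (eigenvector ν s τ z) y = Complex.exp (z / ν * y) :=
  logFun_power hτ ((div_mem_powerStrip_iff hν).2 hz).1 ((div_mem_powerStrip_iff hν).2 hz).2 y

theorem eigenvector_apply (hν : 0 < ν) (hτ : 0 ≤ τ) {z : ℂ} (hz : z ∈ bsStrip ν s)
    (x : Ioi (0 : ℝ)) : eigenvector ν s τ z x = ((x : ℝ) : ℂ) ^ (z / (ν : ℂ)) := by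
  have hx : (0 : ℝ) < x := x.2
  have hx' : ((x : ℝ) : ℂ) ≠ 0 := by exact_mod_cast hx.ne'
  rw [val_eq_logFun, logFun_eigenvector hν hτ hz, Complex.cpow_def_of_ne_zero hx',
    Complex.ofReal_log hx.le, mul_comm]

theorem eigenvector_ne_zero (hν : 0 < ν) (hτ : 0 ≤ τ) {z : ℂ} (hz : z ∈ bsStrip ν s) :
    eigenvector ν s τ z ≠ 0 := by
  intro h
  have h1 := logFun_eigenvector hν hτ hz 0
  rw [h, logFun_zero] at h1
  exact Complex.exp_ne_zero _ h1.symm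

theorem differentiableOn_eigenvector (hν : 0 < ν) (hτ : 0 ≤ τ) :
    DifferentiableOn ℂ (eigenvector ν s τ) (bsStrip ν s) := by
  refine (differentiableOn_power hτ).comp (f := fun z : ℂ => z / (ν : ℂ)) ?_ fun z hz =>
    (div_mem_powerStrip_iff hν).2 hz
  fun_prop

theorem eigenvector_mem_bsD (hν : 0 < ν) (hτ : 0 ≤ τ) {z : ℂ} (hz : z ∈ bsStrip ν s) (k : ℂ) :
    (k • eigenvector ν s τ z, (k * z) • eigenvector ν s τ z) ∈ bsD ν s τ := by
  rw [mem_bsD_iff hν.ne']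
  intro y
  have e : logFun (k • eigenvector ν s τ z) = fun y : ℝ => k * Complex.exp (z / ν * y) := by
    ext y
    rw [logFun_smul, logFun_eigenvector hν hτ hz]
  have h : HasDerivAt (fun y : ℝ => z / ν * (y : ℂ)) (z / ν) y := by
    simpa using (Complex.ofRealCLM.hasDerivAt (x := y)).const_mul (z / ν)
  rw [e]
  refine (h.cexp.const_mul k).congr_deriv ?_
  rw [logFun_smul, logFun_eigenvector hν hτ hz]
  ring

theorem eigenvector_mem_bsOperator (hν : 0 < ν) (hτ : 0 ≤ τ) (γ r : ℝ) {z : ℂ}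
    (hz : z ∈ bsStrip ν s) :
    (eigenvector ν s τ z, bsSymbol γ r z • eigenvector ν s τ z) ∈ bsOperator ν γ r s τ := by
  have h1 := eigenvector_mem_bsD hν hτ hz 1
  rw [one_smul, one_mul] at h1
  refine ⟨_, _, h1, eigenvector_mem_bsD hν hτ hz z, ?_⟩
  simp only [bsSymbol]
  module

theorem dense_span_eigenvector (hν : 0 < ν) (hs : 0 < s) (hτ : 0 ≤ τ) :
    Dense (Submodule.span ℂ (eigenvector ν s τ '' bsStrip ν s) : Set (BSSpace s τ)) := by
  have hν' : (ν : ℂ) ≠ 0 := by exact_mod_cast hν.ne'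
  refine (dense_span_power hs hτ).mono (Submodule.span_mono ?_)
  rintro _ ⟨κ, hκ, rfl⟩
  have e : κ * ν / ν = κ := mul_div_cancel_right₀ κ hν'
  refine ⟨κ * ν, (div_mem_powerStrip_iff hν).1 (e.symm ▸ hκ), ?_⟩
  rw [eigenvector, e]

/-- By the identity theorem, a functional that vanishes on the eigenvectors near one point of the strip
vanishes on all of them. -/
theorem eq_zero_of_eventually_eigenvector (hν : 0 < ν) (hs : 0 < s) (hτ : 0 ≤ τ) {z₀ : ℂ}
    (hz₀ : z₀ ∈ bsStrip ν s) (φ : BSSpace s τ →L[ℂ] ℂ)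
    (h : ∀ᶠ z in 𝓝 z₀, φ (eigenvector ν s τ z) = 0) : φ = 0 := by
  have ha : AnalyticOnNhd ℂ (fun z => φ (eigenvector ν s τ z)) (bsStrip ν s) :=
    (φ.differentiable.comp_differentiableOn (differentiableOn_eigenvector hν hτ)).analyticOnNhd
      (isOpen_bsStrip ν s)
  have h0 := ha.eqOn_zero_of_preconnected_of_eventuallyEq_zero (isPreconnected_bsStrip ν s) hz₀ h
  refine ContinuousLinearMap.ext_on (dense_span_eigenvector hν hs hτ) ?_
  rintro _ ⟨z, hz, rfl⟩
  exact h0 hz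

end BSSpace

/-- The semigroup generated by the Black–Scholes operator is determined by its action on the powers. -/
theorem C0Semigroup.eq_of_generator_eq_bsOperator {ν γ r s τ : ℝ} (hν : 0 < ν) (hs : 0 < s)
    (hτ : 0 ≤ τ) {T T' : C0Semigroup (BSSpace s τ)} (h : T.generator = bsOperator ν γ r s τ)
    (h' : T'.generator = bsOperator ν γ r s τ) : T = T' := by
  refine C0Semigroup.ext (funext fun t => ?_)
  refine ContinuousLinearMap.ext_on (BSSpace.dense_span_eigenvector hν hs hτ) ?_
  rintro _ ⟨z, hz, rfl⟩
  have hz' := BSSpace.eigenvector_mem_bsOperator hν hτ γ r hz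
  rw [T.op_apply_of_mem_generator (h ▸ hz'), T'.op_apply_of_mem_generator (h' ▸ hz')]

/-! ### A local inverse of the symbol -/

/-- The branch `-γ/2 + √(w + r + γ²/4)` of the inverse of `z² + γ z - r`, with the principal square
root. -/
noncomputable def bsSymbolInv (γ r : ℝ) (w : ℂ) : ℂ :=
  -(γ : ℂ) / 2 + (w + r + (γ : ℂ) ^ 2 / 4) ^ (2⁻¹ : ℂ)

theorem bsSymbol_bsSymbolInv (γ r : ℝ) (w : ℂ) : bsSymbol γ r (bsSymbolInv γ r w) = w := by
  have h : ((w + r + (γ : ℂ) ^ 2 / 4) ^ (2⁻¹ : ℂ)) ^ 2 = w + r + (γ : ℂ) ^ 2 / 4 := by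
    have := Complex.cpow_nat_inv_pow (w + r + (γ : ℂ) ^ 2 / 4) (n := 2) two_ne_zero
    exact_mod_cast this
  rw [bsSymbol, bsSymbolInv]
  linear_combination h

theorem bsSymbolInv_bsSymbol {γ : ℝ} (r : ℝ) {z : ℂ} (hz : 0 < z.re + γ / 2) :
    bsSymbolInv γ r (bsSymbol γ r z) = z := by
  have e : bsSymbol γ r z + r + (γ : ℂ) ^ 2 / 4 = (z + γ / 2) ^ 2 := by
    rw [bsSymbol]
    ring
  have hre : 0 < (z + (γ : ℂ) / 2).re := by
    have : ((γ : ℂ) / 2).re = γ / 2 := by simp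
    rwa [Complex.add_re, this]
  rw [bsSymbolInv, e, Complex.sq_cpow_two_inv hre]
  ring

theorem differentiableAt_bsSymbolInv (γ r : ℝ) {w : ℂ} (hw : 0 < w.im) :
    DifferentiableAt ℂ (bsSymbolInv γ r) w := by
  refine DifferentiableAt.const_add _ (DifferentiableAt.cpow_const (by fun_prop) ?_)
  refine Or.inr (ne_of_gt ?_)
  have : (w + r + (γ : ℂ) ^ 2 / 4).im = w.im := by
    have h : ((γ : ℂ) ^ 2 / 4).im = 0 := by
      have : ((γ : ℂ) ^ 2 / 4) = ((γ ^ 2 / 4 : ℝ) : ℂ) := by push_cast; rfl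
      rw [this, Complex.ofReal_im]
    simp [h]
  rwa [this]

/-- For `a > ν` the line `Re z = a` contains a point at which the symbol is a positive multiple of `i`,
because `a² + γ a - r = (a - ν) (a + r / ν) > 0`. -/
theorem exists_bsSymbol_eq_mul_I {ν r a : ℝ} (hν : 0 < ν) (hr : 0 < r) (ha : ν < a) :
    ∃ (z : ℂ) (t : ℝ), z.re = a ∧ 0 < t ∧ bsSymbol (r / ν - ν) r z = t * Complex.I := by
  have hrν : 0 < r / ν := by positivity
  set b := Real.sqrt ((a - ν) * (a + r / ν)) with hb
  have hpos : 0 < (a - ν) * (a + r / ν) := mul_pos (by linarith) (by linarith)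
  have hb0 : 0 < b := Real.sqrt_pos.2 hpos
  have hb2 : b ^ 2 = (a - ν) * (a + r / ν) := Real.sq_sqrt hpos.le
  refine ⟨⟨a, b⟩, b * (2 * a + (r / ν - ν)), rfl, mul_pos hb0 (by linarith), ?_⟩
  have hc : a ^ 2 - b ^ 2 + (r / ν - ν) * a - r = 0 := by
    rw [hb2]; field_simp; ring
  apply Complex.ext
  · rw [bsSymbol]
    simp only [pow_two, Complex.sub_re, Complex.add_re, Complex.mul_re, Complex.ofReal_re,
      Complex.ofReal_im, Complex.I_re, Complex.I_im]
    linarith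
  · rw [bsSymbol]
    simp only [pow_two, Complex.sub_im, Complex.add_im, Complex.mul_im, Complex.ofReal_re,
      Complex.ofReal_im, Complex.I_re, Complex.I_im]
    ring

/-! ### The Black–Scholes semigroup -/

theorem mainTheorem3 (σ r ν γ s τ : ℝ) (hσ : 0 < σ) (hr : 0 < r)
    (hν : ν = σ / Real.sqrt 2) (hν1 : ν < 1) (hγ : γ = r / ν - ν)
    (hs : 1 < s) (hτ : 0 ≤ τ) (hsν : 1 < s * ν) :
    CompleteSpace (BSSpace s τ) ∧ TopologicalSpace.SeparableSpace (BSSpace s τ) ∧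
    (∃! T : C0Semigroup (BSSpace s τ), T.generator = bsOperator ν γ r s τ) ∧
    ∀ T : C0Semigroup (BSSpace s τ), T.generator = bsOperator ν γ r s τ →
      (∃ L : ℂ → BSSpace s τ,
        (∀ z ∈ bsStrip ν s, ∀ x : Set.Ioi (0 : ℝ), L z x = ((x : ℝ) : ℂ) ^ (z / (ν : ℂ))) ∧
        WeaklyHolomorphicOn L (bsStrip ν s) ∧
        ∃ (c : ℂ) (ρ : ℝ) (ginv : ℂ → ℂ), 0 < ρ ∧
          Metric.ball c ρ ⊆ bsSymbol γ r '' bsStrip ν s ∧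
          (∃ t : ℝ, (t : ℂ) * Complex.I ∈ Metric.ball c ρ) ∧
          (∀ a : ℝ, (a : ℂ) ∉ Metric.ball c ρ) ∧
          DifferentiableOn ℂ ginv (Metric.ball c ρ) ∧
          Set.MapsTo ginv (Metric.ball c ρ) (bsStrip ν s) ∧
          (∀ w ∈ Metric.ball c ρ, bsSymbol γ r (ginv w) = w) ∧
          SpectralCriterion T.generator (Metric.ball c ρ) (L ∘ ginv)) ∧
      HasC2ImaginaryEigenfields T.generator ∧
      ∃ μ : MeasureTheory.Measure (BSSpace s τ), IsInvariantMixingFullSupport T μ := by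
  have hν0 : 0 < ν := by rw [hν]; positivity
  have hs0 : 0 < s := by linarith
  have hcomplete := BSSpace.completeSpace (s := s) (τ := τ) hs0 hτ
  have hsep := BSSpace.separableSpace (s := s) (τ := τ) hs0 hτ
  have hsc : SecondCountableTopology (BSSpace s τ) := UniformSpace.secondCountable_of_separable _
  refine ⟨hcomplete, hsep, ⟨BSSpace.diffusion hs0 hτ (ν ^ 2).toNNReal (γ * ν) r,
    BSSpace.generator_diffusion hs0 hτ hν0 γ r, fun T' hT' =>
      C0Semigroup.eq_of_generator_eq_bsOperator hν0 hs0 hτ hT'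
        (BSSpace.generator_diffusion hs0 hτ hν0 γ r)⟩, fun T hT => ?_⟩
  -- a point `z₀` of the strip that the symbol maps to the imaginary axis
  have hsν' : ν < s * ν := by nlinarith
  obtain ⟨a, ha, ha'⟩ := exists_between hsν'
  obtain ⟨z₀, t₀, hz₀, ht₀, hgz₀⟩ := exists_bsSymbol_eq_mul_I hν0 hr ha
  rw [← hγ] at hgz₀
  have hz₀s : z₀ ∈ bsStrip ν s := ⟨by rw [hz₀]; linarith, by rwa [hz₀]⟩
  have hre : 0 < z₀.re + γ / 2 := by
    have : 0 < r / ν := by positivity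
    rw [hz₀, hγ]; linarith
  have hinv : bsSymbolInv γ r (t₀ * Complex.I) = z₀ := by rw [← hgz₀, bsSymbolInv_bsSymbol r hre]
  -- a ball around its image on which the branch is holomorphic with values in the strip
  have him : 0 < ((t₀ : ℂ) * Complex.I).im := by simpa using ht₀
  have hev : ∀ᶠ w in 𝓝 ((t₀ : ℂ) * Complex.I), 0 < w.im ∧ bsSymbolInv γ r w ∈ bsStrip ν s := by
    refine ((Complex.continuous_im.tendsto _).eventually (lt_mem_nhds him)).and ?_
    refine (differentiableAt_bsSymbolInv γ r him).continuousAt.eventually_mem ?_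
    rw [hinv]
    exact (BSSpace.isOpen_bsStrip ν s).mem_nhds hz₀s
  obtain ⟨ρ, hρ, hball⟩ := Metric.eventually_nhds_iff_ball.1 hev
  set c : ℂ := (t₀ : ℂ) * Complex.I with hc
  have hdiff : DifferentiableOn ℂ (bsSymbolInv γ r) (Metric.ball c ρ) := fun w hw =>
    (differentiableAt_bsSymbolInv γ r (hball w hw).1).differentiableWithinAt
  have hmaps : MapsTo (bsSymbolInv γ r) (Metric.ball c ρ) (bsStrip ν s) := fun w hw =>
    (hball w hw).2
  have hL := BSSpace.differentiableOn_eigenvector (s := s) hν0 hτ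
  have hF : DifferentiableOn ℂ (BSSpace.eigenvector ν s τ ∘ bsSymbolInv γ r) (Metric.ball c ρ) :=
    hL.comp hdiff hmaps
  have heig : ∀ w ∈ Metric.ball c ρ, ((BSSpace.eigenvector ν s τ ∘ bsSymbolInv γ r) w,
      w • (BSSpace.eigenvector ν s τ ∘ bsSymbolInv γ r) w) ∈ T.generator := by
    intro w hw
    have h := BSSpace.eigenvector_mem_bsOperator hν0 hτ γ r (hmaps hw)
    rw [bsSymbol_bsSymbolInv] at h
    rw [hT]
    exact h
  have htotal : ∀ φ : BSSpace s τ →L[ℂ] ℂ, (∀ w ∈ Metric.ball c ρ,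
      φ ((BSSpace.eigenvector ν s τ ∘ bsSymbolInv γ r) w) = 0) → φ = 0 := by
    intro φ hφ
    refine BSSpace.eq_zero_of_eventually_eigenvector hν0 hs0 hτ hz₀s φ ?_
    have hg : Continuous (bsSymbol γ r) := by unfold bsSymbol; fun_prop
    have h1 : ∀ᶠ z in 𝓝 z₀, bsSymbol γ r z ∈ Metric.ball c ρ :=
      (hg.tendsto z₀).eventually_mem (by rw [hgz₀]; exact Metric.ball_mem_nhds c hρ)
    have h2 : ∀ᶠ z in 𝓝 z₀, 0 < z.re + γ / 2 :=
      ((Complex.continuous_re.add continuous_const).tendsto z₀).eventually (lt_mem_nhds hre)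
    filter_upwards [h1, h2] with z hz1 hz2
    have h := hφ _ hz1
    rwa [Function.comp_apply, bsSymbolInv_bsSymbol r hz2] at h
  have hpre : IsPreconnected (Metric.ball c ρ) := (convex_ball c ρ).isPreconnected
  have hJ : ∀ t ∈ Icc t₀ (t₀ + ρ / 2), (t : ℂ) * Complex.I ∈ Metric.ball c ρ := by
    intro t ht
    rw [Metric.mem_ball, dist_eq_norm, hc, ← sub_mul, norm_mul, Complex.norm_I, mul_one,
      ← Complex.ofReal_sub, Complex.norm_real, Real.norm_of_nonneg (sub_nonneg.2 ht.1)]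
    linarith [ht.2]
  have hlt : t₀ < t₀ + ρ / 2 := by linarith
  refine ⟨⟨BSSpace.eigenvector ν s τ, fun z hz x => BSSpace.eigenvector_apply hν0 hτ hz x,
      fun φ => φ.differentiable.comp_differentiableOn hL, c, ρ, bsSymbolInv γ r, hρ,
      fun w hw => ⟨_, hmaps hw, bsSymbol_bsSymbolInv γ r w⟩, ⟨t₀, Metric.mem_ball_self hρ⟩,
      fun x hx => (hball x hx).1.ne' (Complex.ofReal_im x), hdiff, hmaps,
      fun w _ => bsSymbol_bsSymbolInv γ r w, ?_⟩, ?_, ?_⟩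
  · exact
      { isOpen := Metric.isOpen_ball
        isConnected := ⟨⟨c, Metric.mem_ball_self hρ⟩, hpre⟩
        meets_imaginary_axis := ⟨t₀, Metric.mem_ball_self hρ⟩
        ne_zero := fun w hw => BSSpace.eigenvector_ne_zero hν0 hτ (hmaps hw)
        eigen := heig
        weaklyHolomorphic := fun φ => φ.differentiable.comp_differentiableOn hF
        total := htotal }
  · exact hasC2ImaginaryEigenfields_of_differentiableOn Metric.isOpen_ball hpre hF htotal heig hlt hJ
  · exact exists_isInvariantMixingFullSupport_of_differentiableOn T Metric.isOpen_ball hpre hF htotal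
      heig hlt hJ
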